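/- Let $\tau>0$, let $H$ be a Hilbert space over $\mathbb K=\mathbb R$ or $\mathbb C$, and let $\Phi\in\mathcal L(H)$ with $\|\Phi\|_{\mathcal L(H)}\le 1$. Put $\mathcal H:=L^2(0,\tau;H)$. An operator $A$ in a normed space $X$ is called accretive if $\|x+tAx\|\ge\|x\|$ for all $x\in D(A)$ and $t>0$, and m-accretive if in addition $\lambda I+A\colon D(A)\to X$ is surjective for every $\lambda>0$. (a) Let $V$ be a Hilbert space over $\mathbb K$ that is continuously and densely embedded in $H$, let $V'$ be the space of bounded antilinear functionals on $V$, and identify $x\in H$ with the functional $w\mapsto (x\mid w)_H$, so that $V\hookrightarrow H\hookrightarrow V'$. Let $\mathfrak a\colon[0,\tau]\times V\times V\to\mathbb K$ be such that $\mathfrak a(t,\cdot,\cdot)$ is sesquilinear for all $t\in[0,\tau]$, $\mathfrak a(\cdot,v,w)$ is measurable for all $v,w\in V$, there is $M\ge 0$ with $|\mathfrak a(t,v,w)|\le M\|v\|_V\|w\|_V$ for all $t\in[0,\tau]$ and $v,w\in V$, and $\mathfrak a$ is coercive, i.e. there is $\alpha>0$ with $\operatorname{Re}\mathfrak a(t,v,v)\ge\alpha\|v\|_V^2$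 for all $t\in[0,\tau]$ and $v\in V$. Let $\mathcal A(t)\in\mathcal L(V,V')$ be given by $\langle\mathcal A(t)v,w\rangle=\mathfrak a(t,v,w)$. For $u\in L^2(0,\tau;V)$ let $\mathcal A(\cdot)u\in L^2(0,\tau;V')$ be the element $g$ such that for every $w\in V$ one has $\langle g(t),w\rangle=\mathfrak a(t,u(t),w)$ for almost every $t$ (if $V$ is separable, this means $g(t)=\mathcal A(t)u(t)$ for almost every $t$). Let $MR(V,V'):=H^1(0,\tau;V')\cap L^2(0,\tau;V)\subset C([0,\tau];H)$. Then the operator $C$ in $\mathcal H$ given by $$D(C):=\{u\in MR(V,V') : \dot u+\mathcal A(\cdot)u\in\mathcal H,\ u(0)=\Phi u(\tau)\},\qquad Cu:=\dot u+\mathcal A(\cdot)u,$$ is m-accretive. (b) The operator $B$ in $\mathcal H$ given by $$D(B):=\{u\in H^1(0,\tau;H) : u(0)=\Phi u(\tau)\},\qquad Bu:=u',$$ is m-accretive. -/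

import Mathlib

open MeasureTheory Set Filter Topology
open scoped ENNReal ContDiff InnerProductSpace

namespace TimeBVP

/-! ### Bochner spaces and weak derivatives on `(0, τ)` -/

/-- The Bochner space `L²(0, τ; X)`. -/
abbrev L2 (τ : ℝ) (X : Type*) [NormedAddCommGroup X] : Type _ :=
  Lp X 2 (volume.restrict (Ioo (0 : ℝ) τ))

/-- `u'` is the weak (distributional) derivative of `u` on `(0, τ)`: for every real test function
`φ ∈ C_c^∞(0, τ)` one has `∫ φ'(t) u(t) dt = - ∫ φ(t) u'(t) dt` (Bochner integrals in `X`). -/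
def HasWeakDeriv (τ : ℝ) {X : Type*} [NormedAddCommGroup X] [NormedSpace ℝ X]
    (u u' : ℝ → X) : Prop :=
  ∀ φ : ℝ → ℝ, ContDiff ℝ ∞ φ → HasCompactSupport φ → tsupport φ ⊆ Ioo 0 τ →
    ∫ t in Ioo 0 τ, deriv φ t • u t = -∫ t in Ioo 0 τ, φ t • u' t

section Boundary

variable {𝕜 : Type*} [RCLike 𝕜] {H : Type*} [NormedAddCommGroup H] [NormedSpace 𝕜 H]

/-- The time-boundary condition `u(0) = Φ u(τ)` for a class `u ∈ L²(0, τ; H)` that has a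
representative `w` which is continuous on `[0, τ]` (such a representative is unique on `[0, τ]`,
and its values are the values `u(0)` and `u(τ)`). -/
def TimeBoundary (τ : ℝ) (Φ : H →L[𝕜] H) (u : L2 τ H) : Prop :=
  ∃ w : ℝ → H, ContinuousOn w (Icc 0 τ) ∧ u =ᵐ[volume.restrict (Ioo 0 τ)] w ∧ w 0 = Φ (w τ)

end Boundary

/-! ### m-accretive operators -/

/-- An unbounded operator `A` in `X` is accretive if `‖x + t A x‖ ≥ ‖x‖` for all `x ∈ D(A)`, `t > 0`;
it is m-accretive if moreover `λ I + A : D(A) → X` is surjective for every `λ > 0`. -/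
structure IsMAccretive {𝕜 : Type*} [RCLike 𝕜] {X : Type*} [NormedAddCommGroup X] [NormedSpace 𝕜 X]
    (A : X →ₗ.[𝕜] X) : Prop where
  accretive : ∀ (x : A.domain) (t : ℝ), 0 < t → ‖(x : X)‖ ≤ ‖(x : X) + (t : 𝕜) • A x‖
  surjective : ∀ (l : ℝ), 0 < l → ∀ y : X, ∃ x : A.domain, (l : 𝕜) • (x : X) + A x = y

/-! ### Gelfand triple and non-autonomous forms -/

section Form

variable {𝕜 : Type*} [RCLike 𝕜]
  {V : Type*} [NormedAddCommGroup V] [InnerProductSpace 𝕜 V]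
  {H : Type*} [NormedAddCommGroup H] [InnerProductSpace 𝕜 H]

/-- The embedding `H → V'` of the Gelfand triple `V ↪ H ↪ V'` given by `ι : V → H`. Here `V'` is the
space `V →L⋆[𝕜] 𝕜` of bounded antilinear functionals, and `x ∈ H` is identified with the functional
`w ↦ (x | ι w)_H`, the scalar product being linear in `x` (Mathlib's `⟪ι w, x⟫`). -/
noncomputable def toAntiDual (ι : V →L[𝕜] H) : H →L[𝕜] (V →L⋆[𝕜] 𝕜) :=
  ((innerSL 𝕜).comp ι).flip

theorem toAntiDual_apply (ι : V →L[𝕜] H) (x : H) (w : V) : toAntiDual ι x w = ⟪ι w, x⟫_𝕜 := rfl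

/-- `a : [0, τ] × V × V → 𝕜` is a non-autonomous form: every `a t` is sesquilinear (linear in the
first, antilinear in the second variable), `t ↦ a t v w` is Lebesgue measurable on `[0, τ]` for all
`v, w`, and `|a t v w| ≤ M ‖v‖ ‖w‖` with `M` independent of `t ∈ [0, τ]`.
The values of `a t` for `t ∉ [0, τ]` play no role. -/
structure IsForm (τ : ℝ) (a : ℝ → V →ₗ[𝕜] V →ₗ⋆[𝕜] 𝕜) : Prop where
  measurable : ∀ v w : V, AEMeasurable (fun t => a t v w) (volume.restrict (Icc 0 τ))
  bounded : ∃ M : ℝ, 0 ≤ M ∧ ∀ t ∈ Icc 0 τ, ∀ v w : V, ‖a t v w‖ ≤ M * ‖v‖ * ‖w‖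

/-- The form is coercive (quasi-coercive with `ω = 0`). -/
def IsCoercive (τ : ℝ) (a : ℝ → V →ₗ[𝕜] V →ₗ⋆[𝕜] 𝕜) : Prop :=
  ∃ α : ℝ, 0 < α ∧ ∀ t ∈ Icc 0 τ, ∀ v : V, α * ‖v‖ ^ 2 ≤ RCLike.re (a t v v)

/-- `g ∈ L²(0, τ; V')` is `𝒜(·)v` for `v ∈ L²(0, τ; V)`, where `⟨𝒜(t)x, w⟩ = a(t, x, w)`: for every
`w ∈ V` one has `⟨g(t), w⟩ = a(t, v(t), w)` for almost every `t`. If `V` is separable this means that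
`g(t) = 𝒜(t)v(t)` in `V'` for almost every `t`, see `IsFormImage.ae_forall`. For a non-separable `V`,
where `t ↦ 𝒜(t)v(t)` may fail to be strongly measurable, it says that `g` is the functional
`w ↦ ∫ a(t, v(t), w(t)) dt` in `L²(0, τ; V)' = L²(0, τ; V')`. -/
def IsFormImage (τ : ℝ) (a : ℝ → V →ₗ[𝕜] V →ₗ⋆[𝕜] 𝕜) (v : L2 τ V) (g : L2 τ (V →L⋆[𝕜] 𝕜)) : Prop :=
  ∀ w : V, ∀ᵐ t ∂(volume.restrict (Ioo 0 τ)), g t w = a t (v t) w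

theorem IsFormImage.ae_forall [TopologicalSpace.SeparableSpace V] {τ : ℝ}
    {a : ℝ → V →ₗ[𝕜] V →ₗ⋆[𝕜] 𝕜} (ha : IsForm τ a) {v : L2 τ V} {g : L2 τ (V →L⋆[𝕜] 𝕜)}
    (h : IsFormImage τ a v g) :
    ∀ᵐ t ∂(volume.restrict (Ioo 0 τ)), ∀ w : V, g t w = a t (v t) w := by
  obtain ⟨M, -, hM⟩ := ha.bounded
  have h1 : ∀ᵐ t ∂(volume.restrict (Ioo 0 τ)), ∀ n : ℕ,
      g t (TopologicalSpace.denseSeq V n) = a t (v t) (TopologicalSpace.denseSeq V n) :=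
    ae_all_iff.2 fun n => h _
  filter_upwards [h1, ae_restrict_mem measurableSet_Ioo] with t ht htm w
  have hc : Continuous (a t (v t)) :=
    AddMonoidHomClass.continuous_of_bound (a t (v t)) (M * ‖v t‖)
      (hM t (Ioo_subset_Icc_self htm) (v t))
  have := (TopologicalSpace.denseRange_denseSeq V).equalizer (g t).continuous hc (funext ht)
  exact congrFun this w

/-- The relation `u ∈ MR(V, V') = H¹(0, τ; V') ∩ L²(0, τ; V)` together with its data: `v` is `u`
considered as an element of `L²(0, τ; V)`, and `d ∈ L²(0, τ; V')` is the weak derivative `u̇` of `u`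
considered as a function with values in `V'`. -/
structure IsMR (τ : ℝ) (ι : V →L[𝕜] H) (u : L2 τ H) (v : L2 τ V) (d : L2 τ (V →L⋆[𝕜] 𝕜)) : Prop where
  emb : (u : ℝ → H) =ᵐ[volume.restrict (Ioo 0 τ)] fun t => ι (v t)
  deriv : HasWeakDeriv τ (fun t => toAntiDual ι (u t)) d

end Form

/-! ### Linearity and uniqueness of weak derivatives -/

section WeakDeriv

variable {τ : ℝ} {X : Type*} [NormedAddCommGroup X] [NormedSpace ℝ X]

theorem integrable_smul_L2 {f : ℝ → X} (hf : MemLp f 2 (volume.restrict (Ioo 0 τ)))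
    {φ : ℝ → ℝ} (hφ : Continuous φ) (hc : HasCompactSupport φ) :
    Integrable (fun t => φ t • f t) (volume.restrict (Ioo 0 τ)) := by
  obtain ⟨C, hC⟩ := hc.exists_bound_of_continuous hφ
  exact (hf.integrable one_le_two).bdd_smul C hφ.aestronglyMeasurable (ae_of_all _ hC)

theorem HasWeakDeriv.congr {u v u' v' : ℝ → X} (h : HasWeakDeriv τ u u')
    (huv : u =ᵐ[volume.restrict (Ioo 0 τ)] v) (huv' : u' =ᵐ[volume.restrict (Ioo 0 τ)] v') :
    HasWeakDeriv τ v v' := by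
  intro φ h1 h2 h3
  have e1 : ∫ t in Ioo 0 τ, deriv φ t • v t = ∫ t in Ioo 0 τ, deriv φ t • u t :=
    integral_congr_ae (by filter_upwards [huv] with t ht; rw [ht])
  have e2 : ∫ t in Ioo 0 τ, φ t • v' t = ∫ t in Ioo 0 τ, φ t • u' t :=
    integral_congr_ae (by filter_upwards [huv'] with t ht; rw [ht])
  rw [e1, e2]
  exact h φ h1 h2 h3

theorem HasWeakDeriv.add {u v u' v' : ℝ → X} (h : HasWeakDeriv τ u u') (k : HasWeakDeriv τ v v')
    (hu : MemLp u 2 (volume.restrict (Ioo 0 τ))) (hv : MemLp v 2 (volume.restrict (Ioo 0 τ)))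
    (hu' : MemLp u' 2 (volume.restrict (Ioo 0 τ))) (hv' : MemLp v' 2 (volume.restrict (Ioo 0 τ))) :
    HasWeakDeriv τ (u + v) (u' + v') := by
  intro φ h1 h2 h3
  have cd : Continuous (deriv φ) := h1.continuous_deriv (by simp)
  simp only [Pi.add_apply, smul_add]
  rw [integral_add (integrable_smul_L2 hu cd h2.deriv) (integrable_smul_L2 hv cd h2.deriv),
    integral_add (integrable_smul_L2 hu' h1.continuous h2) (integrable_smul_L2 hv' h1.continuous h2),
    h φ h1 h2 h3, k φ h1 h2 h3, neg_add]

theorem HasWeakDeriv.smul {𝕜 : Type*} [RCLike 𝕜] [NormedSpace 𝕜 X] [SMulCommClass ℝ 𝕜 X]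
    {u u' : ℝ → X} (h : HasWeakDeriv τ u u') (c : 𝕜) : HasWeakDeriv τ (c • u) (c • u') := by
  intro φ h1 h2 h3
  simp only [Pi.smul_apply, smul_comm _ c]
  rw [integral_smul, integral_smul, h φ h1 h2 h3, smul_neg]

theorem HasWeakDeriv.eq_zero [CompleteSpace X] {u' : ℝ → X} (h : HasWeakDeriv τ 0 u')
    (hu' : MemLp u' 2 (volume.restrict (Ioo 0 τ))) : u' =ᵐ[volume.restrict (Ioo 0 τ)] 0 := by
  have hi : Integrable u' (volume.restrict (Ioo 0 τ)) := hu'.integrable one_le_two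
  have key := isOpen_Ioo.ae_eq_zero_of_integral_contDiff_smul_eq_zero (μ := volume)
    (U := Ioo 0 τ) (f := u') (IntegrableOn.locallyIntegrableOn hi) ?_
  · exact (ae_restrict_iff' measurableSet_Ioo).2 key
  · intro φ h1 h2 h3
    have e := h φ h1 h2 h3
    simp only [Pi.zero_apply, smul_zero, integral_zero] at e
    rw [← setIntegral_eq_integral_of_forall_compl_eq_zero (s := Ioo 0 τ), ← neg_eq_zero, ← e]
    intro t ht
    rw [image_eq_zero_of_notMem_tsupport (fun hh => ht (h3 hh)), zero_smul]

end WeakDeriv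

section BoundaryLinear

variable {𝕜 : Type*} [RCLike 𝕜] {H : Type*} [NormedAddCommGroup H] [NormedSpace 𝕜 H]
  {τ : ℝ} {Φ : H →L[𝕜] H}

theorem TimeBoundary.zero : TimeBoundary τ Φ (0 : L2 τ H) :=
  ⟨0, continuousOn_const, Lp.coeFn_zero _ _ _, by simp⟩

theorem TimeBoundary.add {u v : L2 τ H} (hu : TimeBoundary τ Φ u) (hv : TimeBoundary τ Φ v) :
    TimeBoundary τ Φ (u + v) := by
  obtain ⟨x, x1, x2, x3⟩ := hu
  obtain ⟨y, y1, y2, y3⟩ := hv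
  exact ⟨x + y, x1.add y1, (Lp.coeFn_add u v).trans (x2.add y2), by simp [x3, y3]⟩

theorem TimeBoundary.smul {u : L2 τ H} (hu : TimeBoundary τ Φ u) (c : 𝕜) :
    TimeBoundary τ Φ (c • u) := by
  obtain ⟨x, x1, x2, x3⟩ := hu
  exact ⟨c • x, x1.const_smul c, (Lp.coeFn_smul c u).trans (x2.const_smul c), by simp [x3]⟩

end BoundaryLinear

/-! ### The operator `C = d/dt + 𝒜(·)` -/

section OperatorC

variable {𝕜 : Type*} [RCLike 𝕜]
  {V : Type*} [NormedAddCommGroup V] [InnerProductSpace 𝕜 V]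
  {H : Type*} [NormedAddCommGroup H] [InnerProductSpace 𝕜 H]

/-- The graph of `C`: all pairs `(u, f)` in `L²(0, τ; H) × L²(0, τ; H)` with `u ∈ MR(V, V')`,
`u̇ + 𝒜(·)u = f` in `L²(0, τ; V')` and `u(0) = Φ u(τ)`. -/
def graphC (τ : ℝ) (ι : V →L[𝕜] H) (a : ℝ → V →ₗ[𝕜] V →ₗ⋆[𝕜] 𝕜) (Φ : H →L[𝕜] H) :
    Submodule 𝕜 (L2 τ H × L2 τ H) where
  carrier := {p | (∃ (v : L2 τ V) (d g : L2 τ (V →L⋆[𝕜] 𝕜)), IsMR τ ι p.1 v d ∧ IsFormImage τ a v g ∧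
    ∀ᵐ t ∂(volume.restrict (Ioo 0 τ)), d t + g t = toAntiDual ι (p.2 t)) ∧ TimeBoundary τ Φ p.1}
  zero_mem' := by
    refine ⟨⟨0, 0, 0, ⟨?_, ?_⟩, ?_, ?_⟩, TimeBoundary.zero⟩
    · filter_upwards [Lp.coeFn_zero H 2 (volume.restrict (Ioo 0 τ)),
        Lp.coeFn_zero V 2 (volume.restrict (Ioo 0 τ))] with t h1 h2
      simp only [Prod.fst_zero, h1, h2, Pi.zero_apply, map_zero]
    · have h0 : HasWeakDeriv τ (0 : ℝ → (V →L⋆[𝕜] 𝕜)) 0 := fun φ _ _ _ => by simp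
      refine h0.congr ?_ (Lp.coeFn_zero _ _ _).symm
      filter_upwards [Lp.coeFn_zero H 2 (volume.restrict (Ioo 0 τ))] with t h1
      simp only [Prod.fst_zero, h1, Pi.zero_apply, map_zero]
    · intro w
      filter_upwards [Lp.coeFn_zero (V →L⋆[𝕜] 𝕜) 2 (volume.restrict (Ioo 0 τ)),
        Lp.coeFn_zero V 2 (volume.restrict (Ioo 0 τ))] with t h1 h2
      rw [h1, h2, Pi.zero_apply, Pi.zero_apply, map_zero, LinearMap.zero_apply,
        _root_.zero_apply]
    · filter_upwards [Lp.coeFn_zero (V →L⋆[𝕜] 𝕜) 2 (volume.restrict (Ioo 0 τ)),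
        Lp.coeFn_zero H 2 (volume.restrict (Ioo 0 τ))] with t h1 h2
      simp only [Prod.snd_zero, h1, h2, Pi.zero_apply, map_zero, add_zero]
  add_mem' := by
    rintro ⟨u₁, f₁⟩ ⟨u₂, f₂⟩ ⟨⟨v₁, d₁, g₁, ⟨e₁, w₁⟩, i₁, q₁⟩, b₁⟩ ⟨⟨v₂, d₂, g₂, ⟨e₂, w₂⟩, i₂, q₂⟩, b₂⟩
    refine ⟨⟨v₁ + v₂, d₁ + d₂, g₁ + g₂, ⟨?_, ?_⟩, ?_, ?_⟩, b₁.add b₂⟩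
    · filter_upwards [e₁, e₂, Lp.coeFn_add u₁ u₂, Lp.coeFn_add v₁ v₂] with t h1 h2 h3 h4
      simp only [Prod.mk_add_mk, h3, h4, Pi.add_apply, map_add]
      rw [← h1, ← h2]
    · refine (w₁.add w₂ ((toAntiDual ι).comp_memLp' (Lp.memLp u₁))
        ((toAntiDual ι).comp_memLp' (Lp.memLp u₂)) (Lp.memLp d₁) (Lp.memLp d₂)).congr ?_
        (Lp.coeFn_add d₁ d₂).symm
      filter_upwards [Lp.coeFn_add u₁ u₂] with t h3
      simp only [Prod.mk_add_mk, h3, Pi.add_apply, map_add]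
    · intro w
      filter_upwards [i₁ w, i₂ w, Lp.coeFn_add g₁ g₂, Lp.coeFn_add v₁ v₂] with t h1 h2 h3 h4
      rw [h3, h4, Pi.add_apply, Pi.add_apply, map_add, LinearMap.add_apply,
        _root_.add_apply, h1, h2]
    · filter_upwards [q₁, q₂, Lp.coeFn_add d₁ d₂, Lp.coeFn_add g₁ g₂, Lp.coeFn_add f₁ f₂]
        with t h1 h2 h3 h4 h5
      simp only [Prod.mk_add_mk, h3, h4, h5, Pi.add_apply, map_add]
      rw [← h1, ← h2]
      abel
  smul_mem' := by
    rintro c ⟨u, f⟩ ⟨⟨v, d, g, ⟨e, w⟩, i, q⟩, b⟩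
    refine ⟨⟨c • v, c • d, c • g, ⟨?_, ?_⟩, ?_, ?_⟩, b.smul c⟩
    · filter_upwards [e, Lp.coeFn_smul c u, Lp.coeFn_smul c v] with t h1 h3 h4
      simp only [Prod.smul_mk, h3, h4, Pi.smul_apply, map_smul]
      rw [← h1]
    · refine (w.smul c).congr ?_ (Lp.coeFn_smul c d).symm
      filter_upwards [Lp.coeFn_smul c u] with t h3
      simp only [Prod.smul_mk, h3, Pi.smul_apply, map_smul]
    · intro w
      filter_upwards [i w, Lp.coeFn_smul c g, Lp.coeFn_smul c v] with t h1 h3 h4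
      simp [h1, h3, h4]
    · filter_upwards [q, Lp.coeFn_smul c d, Lp.coeFn_smul c g, Lp.coeFn_smul c f] with t h1 h3 h4 h5
      simp only [Prod.smul_mk, h3, h4, h5, Pi.smul_apply, map_smul]
      rw [← h1, smul_add]

/-- The operator `C = d/dt + 𝒜(·)` in `L²(0, τ; H)` with
`D(C) = {u ∈ MR(V, V') : u̇ + 𝒜(·)u ∈ L²(0, τ; H), u(0) = Φ u(τ)}`. -/
noncomputable def opC (τ : ℝ) (ι : V →L[𝕜] H) (a : ℝ → V →ₗ[𝕜] V →ₗ⋆[𝕜] 𝕜) (Φ : H →L[𝕜] H) :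
    L2 τ H →ₗ.[𝕜] L2 τ H :=
  (graphC τ ι a Φ).toLinearPMap

/-- `graphC` is the graph of an operator, namely of `opC`. -/
theorem graph_opC [CompleteSpace H] {τ : ℝ} {ι : V →L[𝕜] H} (hι : Function.Injective ι)
    (hd : DenseRange ι) (a : ℝ → V →ₗ[𝕜] V →ₗ⋆[𝕜] 𝕜) (Φ : H →L[𝕜] H) :
    (opC τ ι a Φ).graph = graphC τ ι a Φ := by
  refine Submodule.toLinearPMap_graph_eq _ ?_
  rintro ⟨u, f⟩ ⟨⟨v, d, g, ⟨e, w⟩, i, q⟩, -⟩ hu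
  change u = 0 at hu
  subst hu
  have hu0 := Lp.coeFn_zero H 2 (volume.restrict (Ioo 0 τ))
  have hv : ∀ᵐ t ∂(volume.restrict (Ioo 0 τ)), v t = 0 := by
    filter_upwards [e, hu0] with t h1 h2
    apply hι
    rw [← h1, map_zero]
    exact h2
  have hd0 : (d : ℝ → (V →L⋆[𝕜] 𝕜)) =ᵐ[volume.restrict (Ioo 0 τ)] 0 := by
    refine HasWeakDeriv.eq_zero (w.congr ?_ (ae_eq_refl _)) (Lp.memLp d)
    filter_upwards [hu0] with t h2
    simp only [h2, Pi.zero_apply, map_zero]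
  have hf : ∀ x : V, ∀ᵐ t ∂(volume.restrict (Ioo 0 τ)), ⟪ι x, f t⟫_𝕜 = 0 := by
    intro x
    filter_upwards [hv, hd0, i x, q] with t h1 h2 h3 h4
    rw [← toAntiDual_apply, ← h4]
    simp [h2, h3, h1]
  obtain ⟨s, hs, hfs⟩ := (Lp.aestronglyMeasurable f).isSeparable_ae_range
  have hf0 : (f : ℝ → H) =ᵐ[volume.restrict (Ioo 0 τ)] 0 := by
    refine ae_eq_zero_of_forall_dual_of_isSeparable 𝕜 hs (fun c => ?_) hfs
    obtain ⟨y, rfl⟩ := (InnerProductSpace.toDual 𝕜 H).surjective c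
    obtain ⟨b, hb, hby⟩ := mem_closure_iff_seq_limit.1 (hd y)
    choose x hx using hb
    have hall : ∀ᵐ t ∂(volume.restrict (Ioo 0 τ)), ∀ n, ⟪ι (x n), f t⟫_𝕜 = 0 :=
      ae_all_iff.2 fun n => hf (x n)
    filter_upwards [hall] with t ht
    have hl : Tendsto (fun n => ⟪b n, f t⟫_𝕜) atTop (𝓝 ⟪y, f t⟫_𝕜) :=
      hby.inner tendsto_const_nhds
    simp only [← hx, ht] at hl
    exact tendsto_nhds_unique hl tendsto_const_nhds
  exact Lp.ext (hf0.trans (Lp.coeFn_zero _ _ _).symm)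

end OperatorC

/-! ### The operator `B = d/dt` -/

section OperatorB

variable {𝕜 : Type*} [RCLike 𝕜] {H : Type*} [NormedAddCommGroup H] [NormedSpace 𝕜 H]

variable (𝕜) in
/-- `f` is the weak derivative of `u` on `(0, τ)`, where the space `H` over `𝕜 = ℝ` or `ℂ` is
considered as a real space by restriction of scalars. -/
def HasWeakDerivK (τ : ℝ) (u f : ℝ → H) : Prop :=
  letI : NormedSpace ℝ H := NormedSpace.restrictScalars ℝ 𝕜 H
  HasWeakDeriv τ u f

/-- The graph of `B`: all pairs `(u, f)` in `L²(0, τ; H) × L²(0, τ; H)` with `u ∈ H¹(0, τ; H)`,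
`u' = f` and `u(0) = Φ u(τ)`. -/
def graphB (τ : ℝ) (Φ : H →L[𝕜] H) : Submodule 𝕜 (L2 τ H × L2 τ H) where
  carrier := {p | HasWeakDerivK 𝕜 τ p.1 p.2 ∧ TimeBoundary τ Φ p.1}
  zero_mem' := by
    let _ : NormedSpace ℝ H := NormedSpace.restrictScalars ℝ 𝕜 H
    have h0 : HasWeakDeriv τ (0 : ℝ → H) 0 := fun φ _ _ _ => by simp
    exact ⟨h0.congr (Lp.coeFn_zero _ _ _).symm (Lp.coeFn_zero _ _ _).symm, TimeBoundary.zero⟩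
  add_mem' := by
    rintro ⟨u₁, f₁⟩ ⟨u₂, f₂⟩ ⟨w₁, b₁⟩ ⟨w₂, b₂⟩
    let _ : NormedSpace ℝ H := NormedSpace.restrictScalars ℝ 𝕜 H
    exact ⟨(HasWeakDeriv.add w₁ w₂ (Lp.memLp u₁) (Lp.memLp u₂) (Lp.memLp f₁) (Lp.memLp f₂)).congr
      (Lp.coeFn_add u₁ u₂).symm (Lp.coeFn_add f₁ f₂).symm, b₁.add b₂⟩
  smul_mem' := by
    rintro c ⟨u, f⟩ ⟨w, b⟩
    let _ : NormedSpace ℝ H := NormedSpace.restrictScalars ℝ 𝕜 H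
    have : IsScalarTower ℝ 𝕜 H := RestrictScalars.isScalarTower ℝ 𝕜 H
    have : SMulCommClass ℝ 𝕜 H := IsScalarTower.to_smulCommClass
    exact ⟨(HasWeakDeriv.smul w c).congr (Lp.coeFn_smul c u).symm (Lp.coeFn_smul c f).symm, b.smul c⟩

/-- The operator `B = d/dt` in `L²(0, τ; H)` with `D(B) = {u ∈ H¹(0, τ; H) : u(0) = Φ u(τ)}`. -/
noncomputable def opB (τ : ℝ) (Φ : H →L[𝕜] H) : L2 τ H →ₗ.[𝕜] L2 τ H :=
  (graphB τ Φ).toLinearPMap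

/-- `graphB` is the graph of an operator, namely of `opB`. -/
theorem graph_opB [CompleteSpace H] (τ : ℝ) (Φ : H →L[𝕜] H) : (opB τ Φ).graph = graphB τ Φ := by
  refine Submodule.toLinearPMap_graph_eq _ ?_
  rintro ⟨u, f⟩ ⟨w, -⟩ hu
  change u = 0 at hu
  subst hu
  let _ : NormedSpace ℝ H := NormedSpace.restrictScalars ℝ 𝕜 H
  have hf0 : (f : ℝ → H) =ᵐ[volume.restrict (Ioo 0 τ)] 0 :=
    HasWeakDeriv.eq_zero (HasWeakDeriv.congr w (Lp.coeFn_zero _ _ _) (ae_eq_refl _)) (Lp.memLp f)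
  exact Lp.ext (hf0.trans (Lp.coeFn_zero _ _ _).symm)

end OperatorB

end TimeBVP

/-! In a Hilbert space m-accretivity follows from `Re ⟪u, Cu⟫ ≥ 0` together with solvability of `λu
+ Cu = f` for every `λ > 0`. Both parts are reduced to real scalars by taking real parts, and `V'`
is identified with `V` by Riesz, so that the embedding of `V` in `V'` becomes the injective
symmetric positive operator `T = ι†ι`.

Positivity rests on the energy identity `‖u(τ)‖² - ‖u(0)‖² = 2 ∫ ⟪u̇, u⟫`
(`exists_continuous_representative`). Since `u(0) = Φu(τ)` and `‖Φ‖ ≤ 1`, the left side is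
nonnegative, and coercivity makes the form term nonnegative. To prove the identity and the
continuity in `H`, the primitive of `u̇`, which takes values in `V'` only, is regularised by the
resolvents `(T + ε)⁻¹`. The product rule, valid for primitives by Fubini, then gives a uniform
Cauchy estimate.

Existence is a duality argument in the style of Lions. The formal adjoint problem `-T W' + λ T W +
A†W`, `W(τ) - Φ†W(0)` is considered on primitives `W` of functions in `L²(0, τ; V)`. Testing with
`(1 - μt) W(t)` bounds both `W` and `W(τ)` by the data (`weighted_coercivity`). The decreasing
weight trades part of the term `λu` for strict control of the end value, which is needed because
`‖Φ‖ = 1` is allowed. Hahn-Banach and Riesz then produce a weak solution `v` and a vector `ξ`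
(`exists_weak_solution`). Interior test functions give the equation, and arbitrary end values give
`v(τ) = ξ` and `v(0) = Φξ` (`exists_solution`).

For `B` the same results apply with `V = H`. The missing coercivity is borrowed from `λ`: half of
`λu` serves as the form. -/

namespace TimeBVP

/-! ### Primitives of integrable functions -/

section Primitive

variable {E F G : Type*} [NormedAddCommGroup E] [NormedSpace ℝ E]
  [NormedAddCommGroup F] [NormedSpace ℝ F] [NormedAddCommGroup G] [NormedSpace ℝ G]

/-- The primitive of `f` with initial value `c` at `0`. -/
noncomputable def prim (c : E) (f : ℝ → E) (t : ℝ) : E := c + ∫ s in (0 : ℝ)..t, f s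

@[simp] theorem prim_zero (c : E) (f : ℝ → E) : prim c f 0 = c := by simp [prim]

theorem prim_continuousOn {τ : ℝ} (hτ : 0 ≤ τ) (c : E) {f : ℝ → E}
    (hf : IntervalIntegrable f volume 0 τ) : ContinuousOn (prim c f) (Icc 0 τ) := by
  have := intervalIntegral.continuousOn_primitive_interval' hf left_mem_uIcc
  rw [uIcc_of_le hτ] at this
  exact continuousOn_const.add this

theorem intervalIntegrable_bilin_left (L : E →L[ℝ] F →L[ℝ] G) {f : ℝ → E} {g : ℝ → F} {a b : ℝ}
    (hab : a ≤ b) (hf : IntervalIntegrable f volume a b) (hg : ContinuousOn g (Icc a b)) :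
    IntervalIntegrable (fun r => L (f r) (g r)) volume a b := by
  have hf' := (intervalIntegrable_iff_integrableOn_Ioc_of_le hab).1 hf
  rw [intervalIntegrable_iff_integrableOn_Ioc_of_le hab]
  obtain ⟨C, hC⟩ := isCompact_Icc.exists_bound_of_continuousOn hg
  refine Integrable.mono' (hf'.norm.const_mul (‖L‖ * C)) ?_ ?_
  · exact (L.continuous₂).comp_aestronglyMeasurable₂ hf'.1
      ((hg.mono Ioc_subset_Icc_self).aestronglyMeasurable measurableSet_Ioc)
  · filter_upwards [ae_restrict_mem measurableSet_Ioc] with r hr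
    refine (L.le_opNorm₂ _ _).trans ?_
    nlinarith [mul_le_mul_of_nonneg_left (hC r (Ioc_subset_Icc_self hr))
      (mul_nonneg (norm_nonneg L) (norm_nonneg (f r)))]

/-- Fubini: the left side is the integral of `L (f x) (g y)` over the square, and the two terms on
the right are its parts below and above the diagonal. This gives the product rule without any
differentiability. -/
theorem bilin_integral_mul_integral [CompleteSpace E] [CompleteSpace F] [CompleteSpace G]
    (L : E →L[ℝ] F →L[ℝ] G) {f : ℝ → E} {g : ℝ → F} {a b : ℝ} (hab : a ≤ b)
    (hf : IntervalIntegrable f volume a b) (hg : IntervalIntegrable g volume a b) :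
    L (∫ r in a..b, f r) (∫ r in a..b, g r) =
      ∫ r in a..b, (L (f r) (∫ q in a..r, g q) + L (∫ q in a..r, f q) (g r)) := by
  have hf' := (intervalIntegrable_iff_integrableOn_Ioc_of_le hab).1 hf
  have hg' := (intervalIntegrable_iff_integrableOn_Ioc_of_le hab).1 hg
  set μ := volume.restrict (Ioc a b) with hμ
  have hK : Integrable (fun z : ℝ × ℝ => L (f z.1) (g z.2)) (μ.prod μ) :=
    hf'.op_fst_snd (op := fun x y => L x y) (by fun_prop) ⟨‖L‖, L.le_opNorm₂⟩ hg'
  have hs : MeasurableSet {z : ℝ × ℝ | z.2 ≤ z.1} := measurableSet_le measurable_snd measurable_fst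
  have h1 : ∫ z in {z : ℝ × ℝ | z.2 ≤ z.1}, L (f z.1) (g z.2) ∂(μ.prod μ) =
      ∫ r in Ioc a b, L (f r) (∫ q in a..r, g q) := by
    rw [← integral_indicator hs, integral_prod _ (hK.indicator hs)]
    refine setIntegral_congr_fun measurableSet_Ioc fun r hr => ?_
    have hi : IntegrableOn g (Ioc a r) := hg'.mono_set (Ioc_subset_Ioc_right hr.2)
    rw [intervalIntegral.integral_of_le hr.1.le, ← ContinuousLinearMap.integral_comp_comm _ hi]
    have : (fun y => ({z : ℝ × ℝ | z.2 ≤ z.1}).indicator (fun z => L (f z.1) (g z.2)) (r, y)) =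
        (Iic r).indicator (fun y => L (f r) (g y)) := by
      ext y; simp [indicator]
    simp only [this]
    rw [integral_indicator measurableSet_Iic, hμ, Measure.restrict_restrict measurableSet_Iic,
      inter_comm, Ioc_inter_Iic, min_eq_right hr.2]
  have h2 : ∫ z in {z : ℝ × ℝ | z.2 ≤ z.1}ᶜ, L (f z.1) (g z.2) ∂(μ.prod μ) =
      ∫ r in Ioc a b, L (∫ q in a..r, f q) (g r) := by
    rw [← integral_indicator hs.compl, integral_prod_symm _ (hK.indicator hs.compl)]
    refine setIntegral_congr_fun measurableSet_Ioc fun r hr => ?_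
    have hi : IntegrableOn f (Ioc a r) := hf'.mono_set (Ioc_subset_Ioc_right hr.2)
    rw [intervalIntegral.integral_of_le hr.1.le]
    change _ = L.flip (g r) (∫ q in Ioc a r, f q)
    rw [← ContinuousLinearMap.integral_comp_comm _ hi]
    have : (fun x => ({z : ℝ × ℝ | z.2 ≤ z.1}ᶜ).indicator (fun z => L (f z.1) (g z.2)) (x, r)) =
        (Iio r).indicator (fun x => L (f x) (g r)) := by
      ext y; simp [indicator]
    simp only [this]
    rw [integral_indicator measurableSet_Iio, hμ, Measure.restrict_restrict measurableSet_Iio,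
      inter_comm, show Ioc a b ∩ Iio r = Ioo a r by ext; simp; intros; linarith [hr.2],
      ← integral_Ioc_eq_integral_Ioo]
    rfl
  have cf := intervalIntegral.continuousOn_primitive_interval' hf left_mem_uIcc
  have cg := intervalIntegral.continuousOn_primitive_interval' hg left_mem_uIcc
  rw [uIcc_of_le hab] at cf cg
  have i1 := (intervalIntegrable_iff_integrableOn_Ioc_of_le hab).1
    (intervalIntegrable_bilin_left L hab hf cg)
  have i2 := (intervalIntegrable_iff_integrableOn_Ioc_of_le hab).1
    (intervalIntegrable_bilin_left L.flip hab hg cf)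
  simp only [ContinuousLinearMap.flip_apply] at i2
  simp only [intervalIntegral.integral_of_le hab]
  rw [integral_add i1 i2, ← h1, ← h2, integral_add_compl hs hK]
  exact (integral_prod_bilin L hf' hg').symm

/-- The product rule for primitives, integrated. -/
theorem bilin_prim_sub [CompleteSpace E] [CompleteSpace F] [CompleteSpace G]
    (L : E →L[ℝ] F →L[ℝ] G) {f : ℝ → E} {g : ℝ → F} {τ : ℝ}
    (hf : IntervalIntegrable f volume 0 τ) (hg : IntervalIntegrable g volume 0 τ)
    (c : E) (d : F) {t : ℝ} (ht : t ∈ Icc 0 τ) :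
    L (prim c f t) (prim d g t) =
      prim (L c d) (fun r => L (f r) (prim d g r) + L (prim c f r) (g r)) t := by
  have hsub : uIcc 0 t ⊆ uIcc 0 τ := by
    rw [uIcc_of_le ht.1, uIcc_of_le (ht.1.trans ht.2)]; exact Icc_subset_Icc_right ht.2
  have hf := hf.mono_set hsub
  have hg := hg.mono_set hsub
  have key := bilin_integral_mul_integral L ht.1 hf hg
  have cf : ContinuousOn (fun r => ∫ q in (0:ℝ)..r, f q) (Icc 0 t) := by
    simpa [uIcc_of_le ht.1] using intervalIntegral.continuousOn_primitive_interval' hf left_mem_uIcc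
  have cg : ContinuousOn (fun r => ∫ q in (0:ℝ)..r, g q) (Icc 0 t) := by
    simpa [uIcc_of_le ht.1] using intervalIntegral.continuousOn_primitive_interval' hg left_mem_uIcc
  have j1 := intervalIntegrable_bilin_left L ht.1 hf cg
  have j2 := intervalIntegrable_bilin_left L.flip ht.1 hg cf
  have j3 := intervalIntegrable_bilin_left L ht.1 hf (continuousOn_const (c := d))
  have j4 := intervalIntegrable_bilin_left L.flip ht.1 hg (continuousOn_const (c := c))
  simp only [ContinuousLinearMap.flip_apply] at j2 j4
  have e : (fun r => L (f r) (prim d g r) + L (prim c f r) (g r)) = fun r =>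
      (L (f r) d + L c (g r)) + (L (f r) (∫ q in (0:ℝ)..r, g q) + L (∫ q in (0:ℝ)..r, f q) (g r)) := by
    ext r; simp only [prim, map_add, _root_.add_apply]; abel
  unfold prim at e ⊢
  rw [e, intervalIntegral.integral_add (j3.add j4) (j1.add j2), ← key,
    intervalIntegral.integral_add j3 j4]
  have e3 : ∫ r in (0:ℝ)..t, L (f r) d = L (∫ r in (0:ℝ)..t, f r) d :=
    (L.flip d).intervalIntegral_comp_comm hf
  have e4 : ∫ r in (0:ℝ)..t, L c (g r) = L c (∫ r in (0:ℝ)..t, g r) :=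
    (L c).intervalIntegral_comp_comm hg
  rw [e3, e4]
  simp only [map_add, _root_.add_apply]; abel

theorem integral_Ioo_eq_intervalIntegral {τ : ℝ} (hτ : 0 ≤ τ) (f : ℝ → E) :
    ∫ t in Ioo 0 τ, f t = ∫ t in (0 : ℝ)..τ, f t := by
  rw [intervalIntegral.integral_of_le hτ, integral_Ioc_eq_integral_Ioo]

omit [NormedSpace ℝ E] in
theorem intervalIntegrable_of_integrable_Ioo {τ : ℝ} (hτ : 0 ≤ τ) {f : ℝ → E}
    (hf : Integrable f (volume.restrict (Ioo 0 τ))) : IntervalIntegrable f volume 0 τ :=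
  (intervalIntegrable_iff_integrableOn_Ioo_of_le hτ).2 hf

end Primitive

/-! ### Functions with a weak derivative are primitives -/

section DuBoisReymond

variable {X : Type*} [NormedAddCommGroup X] [NormedSpace ℝ X] [CompleteSpace X]

/-- The primitive from `0` vanishes to the left of the support of `χ`, and to the right of it
because `χ` has mean zero. -/
theorem exists_primitive_tsupport_subset {τ : ℝ} {χ : ℝ → ℝ} (hχ : ContDiff ℝ ∞ χ)
    (hc : HasCompactSupport χ) (hs : tsupport χ ⊆ Ioo 0 τ) (h0 : ∫ t in (0 : ℝ)..τ, χ t = 0) :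
    ∃ φ : ℝ → ℝ, ContDiff ℝ ∞ φ ∧ HasCompactSupport φ ∧ tsupport φ ⊆ Ioo 0 τ ∧ deriv φ = χ := by
  have hder : ∀ t, HasDerivAt (fun t => ∫ s in (0:ℝ)..t, χ s) (χ t) t := fun t =>
    intervalIntegral.integral_hasDerivAt_right (hχ.continuous.intervalIntegrable _ _)
      (hχ.continuous.stronglyMeasurableAtFilter _ _) hχ.continuous.continuousAt
  have hd : deriv (fun t => ∫ s in (0:ℝ)..t, χ s) = χ := funext fun t => (hder t).deriv
  obtain ⟨p, q, hpq, hp, hq⟩ : ∃ p q : ℝ, tsupport χ ⊆ Icc p q ∧ 0 < p ∧ q < τ := by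
    rcases (tsupport χ).eq_empty_or_nonempty with h | h
    · exact ⟨1, τ - 1, by simp [h], one_pos, by linarith⟩
    · have hcc : IsCompact (tsupport χ) := hc
      exact ⟨sInf (tsupport χ), sSup (tsupport χ),
        fun x hx => ⟨csInf_le hcc.bddBelow hx, le_csSup hcc.bddAbove hx⟩,
        (hs (hcc.sInf_mem h)).1, (hs (hcc.sSup_mem h)).2⟩
  have hz : ∀ t, t ∉ Icc p q → χ t = 0 := fun t ht =>
    image_eq_zero_of_notMem_tsupport fun h => ht (hpq h)
  have hsupp : Function.support (fun t => ∫ s in (0:ℝ)..t, χ s) ⊆ Icc p q := by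
    intro t ht
    by_contra hn
    apply ht
    rw [mem_Icc, not_and_or, not_le, not_le] at hn
    rcases hn with h | h
    · refine intervalIntegral.integral_zero_ae (ae_of_all _ fun s hsm => hz s fun hh => ?_)
      rcases le_total 0 t with h' | h'
      · rw [uIoc_of_le h'] at hsm; linarith [hsm.2, hh.1]
      · rw [uIoc_of_ge h'] at hsm; linarith [hsm.2, hh.1]
    · change ∫ s in (0:ℝ)..t, χ s = 0
      rw [← intervalIntegral.integral_add_adjacent_intervals
        (hχ.continuous.intervalIntegrable 0 τ) (hχ.continuous.intervalIntegrable τ t), h0, zero_add]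
      refine intervalIntegral.integral_zero_ae (ae_of_all _ fun s hsm => hz s fun hh => ?_)
      rcases le_total τ t with h' | h'
      · rw [uIoc_of_le h'] at hsm; linarith [hsm.1, hh.2]
      · rw [uIoc_of_ge h'] at hsm; linarith [hsm.1, hh.2]
  have hts : tsupport (fun t => ∫ s in (0:ℝ)..t, χ s) ⊆ Icc p q :=
    closure_minimal hsupp isClosed_Icc
  refine ⟨_, ?_, ?_, hts.trans (Icc_subset_Ioo hp hq), hd⟩
  · rw [contDiff_infty_iff_deriv]
    exact ⟨fun t => (hder t).differentiableAt, by rwa [hd]⟩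
  · exact isCompact_Icc.of_isClosed_subset (isClosed_tsupport _) hts

theorem integral_Ioo_of_tsupport_subset {τ : ℝ} {X : Type*} [NormedAddCommGroup X]
    [NormedSpace ℝ X] {φ : ℝ → ℝ} (hs : tsupport φ ⊆ Ioo 0 τ) (f : ℝ → X) :
    ∫ t in Ioo 0 τ, φ t • f t = ∫ t, φ t • f t :=
  setIntegral_eq_integral_of_forall_compl_eq_zero fun t ht => by
    rw [image_eq_zero_of_notMem_tsupport (fun hh => ht (hs hh)), zero_smul]

/-- The lemma of du Bois-Reymond. -/
theorem ae_eq_const_of_hasWeakDeriv_zero {τ : ℝ} (hτ : 0 < τ) {g : ℝ → X}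
    (hg : Integrable g (volume.restrict (Ioo 0 τ))) (h : HasWeakDeriv τ g 0) :
    ∃ c : X, g =ᵐ[volume.restrict (Ioo 0 τ)] fun _ => c := by
  have h2 : (0:ℝ) < τ / 2 := by linarith
  let B : ContDiffBump (τ / 2) := ⟨τ / 8, τ / 4, by linarith, by linarith⟩
  set η := B.normed volume with hη
  have ηd : ContDiff ℝ ∞ η := B.contDiff_normed
  have ηc : HasCompactSupport η := B.hasCompactSupport_normed
  have ηs : tsupport η ⊆ Ioo 0 τ := by
    rw [hη, B.tsupport_normed_eq, Real.closedBall_eq_Icc]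
    exact Icc_subset_Ioo (by change 0 < τ / 2 - τ / 4; linarith)
      (by change τ / 2 + τ / 4 < τ; linarith)
  have ηi : ∫ t in Ioo 0 τ, η t = 1 := by
    have := integral_Ioo_of_tsupport_subset ηs (fun _ => (1:ℝ))
    simp only [smul_eq_mul, mul_one] at this
    rw [this]; exact B.integral_normed
  have bdd : ∀ ψ : ℝ → ℝ, Continuous ψ → HasCompactSupport ψ → ∀ f : ℝ → X,
      Integrable f (volume.restrict (Ioo 0 τ)) →
      Integrable (fun t => ψ t • f t) (volume.restrict (Ioo 0 τ)) := by
    intro ψ hψ hc f hf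
    obtain ⟨C, hC⟩ := hc.exists_bound_of_continuous hψ
    exact hf.bdd_smul C hψ.aestronglyMeasurable (ae_of_all _ hC)
  set c := ∫ t in Ioo 0 τ, η t • g t with hc
  have hcI : Integrable (fun _ : ℝ => c) (volume.restrict (Ioo 0 τ)) := integrable_const _
  refine ⟨c, ?_⟩
  have key := isOpen_Ioo.ae_eq_zero_of_integral_contDiff_smul_eq_zero (μ := volume)
    (U := Ioo 0 τ) (f := fun t => g t - c)
    (IntegrableOn.locallyIntegrableOn (hg.sub hcI)) ?_
  · filter_upwards [(ae_restrict_iff' measurableSet_Ioo).2 key] with t ht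
    exact sub_eq_zero.1 ht
  · intro ψ ψd ψc ψs
    rw [← integral_Ioo_of_tsupport_subset ψs]
    -- As `η` has integral one, `ψ - mη` has mean zero and is the derivative of a test function.
    -- Testing with that function gives `∫ ψ g = m c`.
    set m := ∫ t in Ioo 0 τ, ψ t with hm
    have χc : HasCompactSupport (fun t => ψ t - m * η t) := ψc.sub (ηc.mul_left (f := fun _ => m))
    have iψ : Integrable ψ (volume.restrict (Ioo 0 τ)) :=
      (ψd.continuous.integrable_of_hasCompactSupport ψc).mono_measure Measure.restrict_le_self
    have iη : Integrable η (volume.restrict (Ioo 0 τ)) :=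
      (ηd.continuous.integrable_of_hasCompactSupport ηc).mono_measure Measure.restrict_le_self
    obtain ⟨φ, φd, φc, φs, φ'⟩ := exists_primitive_tsupport_subset (τ := τ)
      (χ := fun t => ψ t - m * η t) (ψd.sub (contDiff_const.mul ηd)) χc
      ((tsupport_sub _ _).trans (union_subset ψs
        ((closure_mono (Function.support_const_smul_subset m η)).trans ηs)))
      (by
        rw [← integral_Ioo_eq_intervalIntegral hτ.le, integral_sub iψ (iη.const_mul m),
          integral_const_mul, ηi, ← hm]; ring)
    have e := h φ φd φc φs
    simp only [φ', Pi.zero_apply, smul_zero, integral_zero, neg_zero, sub_smul, mul_smul] at e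
    rw [integral_sub (bdd ψ ψd.continuous ψc g hg)
      (g := fun t => m • η t • g t) ((bdd η ηd.continuous ηc g hg).smul m),
      integral_smul, ← hc, sub_eq_zero] at e
    simp only [smul_sub]
    rw [integral_sub (bdd ψ ψd.continuous ψc g hg) (iψ.smul_const c), e, integral_smul_const, sub_self]

/-- Integration by parts shows that the primitive of `u'` has weak derivative `u'`, so its
difference from `u` has weak derivative zero and is constant. -/
theorem HasWeakDeriv.ae_eq_prim {τ : ℝ} (hτ : 0 < τ) {u u' : ℝ → X} (h : HasWeakDeriv τ u u')
    (hu : Integrable u (volume.restrict (Ioo 0 τ)))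
    (hu' : Integrable u' (volume.restrict (Ioo 0 τ))) :
    ∃ c : X, u =ᵐ[volume.restrict (Ioo 0 τ)] prim c u' := by
  have hi := intervalIntegrable_of_integrable_Ioo hτ.le hu'
  have hcont := prim_continuousOn hτ.le (0 : X) hi
  have hp : Integrable (prim 0 u') (volume.restrict (Ioo 0 τ)) :=
    (hcont.integrableOn_Icc).mono_set Ioo_subset_Icc_self
  have hw : HasWeakDeriv τ (fun t => u t - prim 0 u' t) 0 := by
    intro φ φd φc φs
    have cd : Continuous (deriv φ) := φd.continuous_deriv (by simp)
    have h0 : φ 0 = 0 := image_eq_zero_of_notMem_tsupport fun hh => lt_irrefl _ (φs hh).1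
    have h1 : φ τ = 0 := image_eq_zero_of_notMem_tsupport fun hh => lt_irrefl _ (φs hh).2
    have hφ : ∀ t, prim 0 (deriv φ) t = φ t := fun t => by
      rw [prim, intervalIntegral.integral_deriv_eq_sub
        (fun s _ => (φd.differentiable (by simp)).differentiableAt)
        (cd.intervalIntegrable _ _), h0]
      simp
    have bdd : ∀ ψ : ℝ → ℝ, Continuous ψ → HasCompactSupport ψ → ∀ f : ℝ → X,
        Integrable f (volume.restrict (Ioo 0 τ)) →
        Integrable (fun t => ψ t • f t) (volume.restrict (Ioo 0 τ)) := by
      intro ψ hψ hc f hf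
      obtain ⟨C, hC⟩ := hc.exists_bound_of_continuous hψ
      exact hf.bdd_smul C hψ.aestronglyMeasurable (ae_of_all _ hC)
    have b1 := bdd _ cd φc.deriv _ hp
    have b2 := bdd _ φd.continuous φc _ hu'
    have pr := bilin_prim_sub (ContinuousLinearMap.lsmul ℝ ℝ : ℝ →L[ℝ] X →L[ℝ] X)
      (cd.intervalIntegrable 0 τ) hi 0 0 (right_mem_Icc.2 hτ.le)
    simp only [hφ, ContinuousLinearMap.lsmul_apply, h1, zero_smul] at pr
    have pr' : ∫ t in Ioo 0 τ, deriv φ t • prim 0 u' t + φ t • u' t = 0 := by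
      rw [integral_Ioo_eq_intervalIntegral hτ.le]
      simpa [prim] using pr.symm
    rw [integral_add b1 b2] at pr'
    simp only [smul_sub, Pi.zero_apply, smul_zero, integral_zero, neg_zero]
    rw [integral_sub (bdd _ cd φc.deriv _ hu) b1, h φ φd φc φs, ← neg_add', add_comm, pr', neg_zero]
  obtain ⟨c, hc⟩ := ae_eq_const_of_hasWeakDeriv_zero hτ (hu.sub hp) hw
  refine ⟨c, ?_⟩
  filter_upwards [hc] with t ht
  rw [Pi.sub_apply, sub_eq_iff_eq_add] at ht
  rw [ht]; simp [prim]

end DuBoisReymond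
/-! ### Functions in `L²(0, τ; V)` with weak derivative in `L²(0, τ; V')` -/

section Energy

variable {V : Type*} [NormedAddCommGroup V] [InnerProductSpace ℝ V] [CompleteSpace V]
  {H : Type*} [NormedAddCommGroup H] [InnerProductSpace ℝ H] [CompleteSpace H]

/-- `S = (T + ε)⁻¹` exists by Lax-Milgram. Both bounds come from expanding `‖TSx + εSx‖² = ‖x‖²`,
where positivity of `T` makes the cross term nonnegative. -/
theorem exists_resolvent (T : V →L[ℝ] V) (hsym : ∀ x y, ⟪T x, y⟫_ℝ = ⟪x, T y⟫_ℝ)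
    (hpos : ∀ x, 0 ≤ ⟪T x, x⟫_ℝ) {ε : ℝ} (hε : 0 < ε) :
    ∃ S : V →L[ℝ] V, (∀ x y, ⟪S x, y⟫_ℝ = ⟪x, S y⟫_ℝ) ∧ (∀ x, S (T x) = T (S x)) ∧
      (∀ x, T (S x) + ε • S x = x) ∧ (∀ x, ‖T (S x)‖ ≤ ‖x‖) ∧ ∀ x, ‖ε • S x‖ ≤ ‖x‖ := by
  set A : V →L[ℝ] V := T + ε • ContinuousLinearMap.id ℝ V with hA
  have hAx : ∀ x, A x = T x + ε • x := fun x => by simp [hA]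
  have hB : ∀ x y, ((innerSL ℝ).comp A : V →L[ℝ] V →L[ℝ] ℝ) x y = ⟪A x, y⟫_ℝ := fun x y => rfl
  have co : _root_.IsCoercive ((innerSL ℝ).comp A : V →L[ℝ] V →L[ℝ] ℝ) := by
    refine ⟨ε, hε, fun u => ?_⟩
    rw [hB, hAx, inner_add_left, real_inner_smul_left, real_inner_self_eq_norm_mul_norm]
    nlinarith [hpos u]
  set e := co.continuousLinearEquivOfBilin with he
  have heA : ∀ x, e x = A x := fun x =>
    (co.unique_continuousLinearEquivOfBilin (f := A x) fun w => rfl).symm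
  have h1 : ∀ x, A (e.symm x) = x := fun x => by rw [← heA]; simp
  have h2 : ∀ x, e.symm (A x) = x := fun x => by rw [← heA]; simp
  have hAsym : ∀ x y, ⟪A x, y⟫_ℝ = ⟪x, A y⟫_ℝ := fun x y => by
    simp [hAx, inner_add_left, inner_add_right, hsym, real_inner_smul_left, real_inner_smul_right]
  have h3 : ∀ x, T (e.symm x) + ε • e.symm x = x := fun x => by rw [← hAx, h1]
  have h4 : ∀ x, ‖x‖ ^ 2 = ‖T (e.symm x)‖ ^ 2 + 2 * (ε * ⟪T (e.symm x), e.symm x⟫_ℝ) +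
      ‖ε • e.symm x‖ ^ 2 := fun x => by
    conv_lhs => rw [← h3 x, norm_add_sq_real, real_inner_smul_right]
  refine ⟨e.symm, fun x y => ?_, fun x => ?_, h3, fun x => ?_, fun x => ?_⟩
  · change ⟪e.symm x, y⟫_ℝ = ⟪x, e.symm y⟫_ℝ
    conv_lhs => rw [← h1 y, ← hAsym, h1]
  · change e.symm (T x) = T (e.symm x)
    conv_lhs => rw [← h1 x]
    have : T (A (e.symm x)) = A (T (e.symm x)) := by simp [hAx]
    rw [this, h2]
  · have := mul_nonneg hε.le (hpos (e.symm x))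
    change ‖T (e.symm x)‖ ≤ ‖x‖
    exact (sq_le_sq₀ (norm_nonneg _) (norm_nonneg _)).1 (by linarith [h4 x, sq_nonneg ‖ε • e.symm x‖])
  · have := mul_nonneg hε.le (hpos (e.symm x))
    change ‖ε • e.symm x‖ ≤ ‖x‖
    exact (sq_le_sq₀ (norm_nonneg _) (norm_nonneg _)).1 (by linarith [h4 x, sq_nonneg ‖T (e.symm x)‖])

/-- `S n = (T + 1/(n+1))⁻¹`. The error `x - S n (T x)` is `S n x / (n+1)`. It tends to zero for `x`
in the range of `T`, which is dense because `T` is symmetric and injective, and the uniform bounds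
extend this to all `x`. -/
theorem exists_regularizers (T : V →L[ℝ] V) (hsym : ∀ x y, ⟪T x, y⟫_ℝ = ⟪x, T y⟫_ℝ)
    (hpos : ∀ x, 0 ≤ ⟪T x, x⟫_ℝ) (hinj : Function.Injective T) :
    ∃ S : ℕ → V →L[ℝ] V, (∀ n x y, ⟪S n x, y⟫_ℝ = ⟪x, S n y⟫_ℝ) ∧
      (∀ n x, ‖S n (T x)‖ ≤ ‖x‖) ∧
      ∀ x, Tendsto (fun n => S n (T x)) atTop (𝓝 x) := by
  choose S h1 h2 h3 h4 h5 using fun n : ℕ =>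
    exists_resolvent T hsym hpos (Nat.one_div_pos_of_nat (α := ℝ) (n := n))
  refine ⟨S, h1, fun n x => by rw [h2]; exact h4 n x, fun x => ?_⟩
  have hd : DenseRange T := by
    change Dense ((LinearMap.range (T : V →ₗ[ℝ] V) : Submodule ℝ V) : Set V)
    rw [Submodule.dense_iff_topologicalClosure_eq_top, Submodule.topologicalClosure_eq_top_iff,
      Submodule.eq_bot_iff]
    intro y hy
    apply hinj
    rw [map_zero, ← inner_self_eq_zero (𝕜 := ℝ), ← hsym]
    exact (Submodule.mem_orthogonal _ _).1 hy _ ⟨T y, rfl⟩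
  rw [Metric.tendsto_atTop]
  intro δ hδ
  obtain ⟨w, hw⟩ := hd.exists_dist_lt x (half_pos hδ)
  have ht : Tendsto (fun n : ℕ => 1 / ((n : ℝ) + 1) * ‖w‖) atTop (𝓝 0) := by
    simpa using tendsto_one_div_add_atTop_nhds_zero_nat.mul_const ‖w‖
  obtain ⟨N, hN⟩ := (ht.eventually (gt_mem_nhds (half_pos hδ))).exists_forall_of_atTop
  refine ⟨N, fun n hn => ?_⟩
  have e1 : x - S n (T x) = (1 / ((n : ℝ) + 1)) • S n (x - T w) +
      (1 / ((n : ℝ) + 1)) • T (S n w) := by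
    have := h3 n x
    rw [map_sub, smul_sub, h2 n w, sub_add_cancel, h2]
    conv_lhs => rw [← this]
    rw [this]
    exact sub_eq_of_eq_add' this.symm
  rw [dist_comm, dist_eq_norm, e1]
  have a1 := h5 n (x - T w)
  have a2 : ‖(1 / ((n : ℝ) + 1)) • T (S n w)‖ ≤ 1 / ((n : ℝ) + 1) * ‖w‖ := by
    rw [norm_smul, Real.norm_of_nonneg (by positivity)]
    exact mul_le_mul_of_nonneg_left (h4 n w) (by positivity)
  rw [dist_eq_norm] at hw
  linarith [norm_add_le ((1 / ((n : ℝ) + 1)) • S n (x - T w)) ((1 / ((n : ℝ) + 1)) • T (S n w)),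
    hN n hn]

/-- The energy identity for a primitive and a symmetric operator. -/
theorem inner_prim_symm (Q : V →L[ℝ] V) (hQ : ∀ x y, ⟪Q x, y⟫_ℝ = ⟪x, Q y⟫_ℝ) {τ : ℝ}
    {D : ℝ → V} (hD : IntervalIntegrable D volume 0 τ) (c : V) {t : ℝ} (ht : t ∈ Icc 0 τ) :
    ⟪prim c D t, Q (prim c D t)⟫_ℝ =
      ⟪c, Q c⟫_ℝ + 2 * ∫ r in (0 : ℝ)..t, ⟪D r, Q (prim c D r)⟫_ℝ := by
  let L : V →L[ℝ] V →L[ℝ] ℝ := (innerSL ℝ).comp Q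
  have hL : ∀ x y, L x y = ⟪Q x, y⟫_ℝ := fun _ _ => rfl
  have := bilin_prim_sub L hD hD c c ht
  rw [hL, hQ] at this
  rw [this, prim, hL, hQ, ← intervalIntegral.integral_const_mul]
  congr 2
  ext r
  rw [hL, hL, hQ, hQ, two_mul]
  congr 1
  rw [real_inner_comm, hQ, real_inner_comm]

/-- A function in `L²(0, τ; V)` with weak derivative `D ∈ L²(0, τ; V')` has a representative which is
continuous with values in `H`, and it satisfies the energy identity. Here `V'` is identified with
`V`, so that the embedding of `V` in `V'` becomes `ι†ι`. -/
theorem exists_continuous_representative {τ : ℝ} (hτ : 0 < τ) {ι : V →L[ℝ] H}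
    (hι : Function.Injective ι) {v D : ℝ → V} (hv : MemLp v 2 (volume.restrict (Ioo 0 τ)))
    (hD : MemLp D 2 (volume.restrict (Ioo 0 τ)))
    (h : HasWeakDeriv τ (fun t => ι.adjoint (ι (v t))) D) :
    ∃ w : ℝ → H, ContinuousOn w (Icc 0 τ) ∧ (fun t => ι (v t)) =ᵐ[volume.restrict (Ioo 0 τ)] w ∧
      ‖w τ‖ ^ 2 - ‖w 0‖ ^ 2 = 2 * ∫ t in Ioo 0 τ, ⟪D t, v t⟫_ℝ := by
  set μ := volume.restrict (Ioo (0:ℝ) τ) with hμ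
  set T : V →L[ℝ] V := ι.adjoint.comp ι with hT
  have hTx : ∀ x, ι.adjoint (ι x) = T x := fun _ => rfl
  have hTi : ∀ x y, ⟪ι x, ι y⟫_ℝ = ⟪x, T y⟫_ℝ := fun x y => by
    rw [← hTx, ContinuousLinearMap.adjoint_inner_right]
  have hTs : ∀ x y, ⟪T x, y⟫_ℝ = ⟪x, T y⟫_ℝ := fun x y => by
    rw [← hTi, real_inner_comm, ← hTi, real_inner_comm]
  have hTp : ∀ x, 0 ≤ ⟪T x, x⟫_ℝ := fun x => by
    rw [hTs, ← hTi]; exact real_inner_self_nonneg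
  have hTinj : Function.Injective T := by
    rw [injective_iff_map_eq_zero]
    intro x hx
    apply hι
    rw [map_zero, ← inner_self_eq_zero (𝕜 := ℝ), hTi, hx, inner_zero_right]
  obtain ⟨S, S1, S3, S4⟩ := exists_regularizers T hTs hTp hTinj
  have vI := hv.integrable one_le_two
  have dI := hD.integrable one_le_two
  have dII := intervalIntegrable_of_integrable_Ioo hτ.le dI
  obtain ⟨c, hc⟩ := h.ae_eq_prim hτ (T.integrable_comp vI) dI
  set W := prim c D with hW
  have hWc : ContinuousOn W (Icc 0 τ) := prim_continuousOn hτ.le c dII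
  have hc : ∀ᵐ t ∂μ, W t = T (v t) := hc.mono fun t ht => ht.symm
  have dominated : ∀ k : ℕ → ℝ → ℝ, (∀ n, AEStronglyMeasurable (k n) μ) →
      (∃ C : ℝ, ∀ n t, |k n t| ≤ C * (‖D t‖ * ‖v t‖)) → ∀ k0 : ℝ → ℝ,
      (∀ t, Tendsto (fun n => k n t) atTop (𝓝 (k0 t))) →
      Tendsto (fun n => ∫ t in Ioo 0 τ, k n t) atTop (𝓝 (∫ t in Ioo 0 τ, k0 t)) := by
    rintro k hk ⟨C, hC⟩ k0 hk0
    exact tendsto_integral_of_dominated_convergence (fun t => C * (‖D t‖ * ‖v t‖)) hk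
      ((hD.norm.integrable_mul hv.norm).const_mul C) (fun n => ae_of_all _ (hC n))
      (ae_of_all _ hk0)
  set δ : ℕ → ℝ := fun n => ∫ t in Ioo 0 τ, ‖D t‖ * ‖S n (T (v t)) - v t‖ with hδ
  have hbound : ∀ n x, ‖S n (T x) - x‖ ≤ 2 * ‖x‖ := fun n x => by
    linarith [norm_sub_le (S n (T x)) x, S3 n x]
  have hmeas : ∀ n, AEStronglyMeasurable (fun t => S n (T (v t))) μ := fun n =>
    ((S n).comp T).continuous.comp_aestronglyMeasurable hv.1
  have δm : ∀ n, AEStronglyMeasurable (fun t => ‖D t‖ * ‖S n (T (v t)) - v t‖) μ := fun n =>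
    hD.1.norm.mul ((hmeas n).sub hv.1).norm
  have δb : ∀ n t, |‖D t‖ * ‖S n (T (v t)) - v t‖| ≤ 2 * (‖D t‖ * ‖v t‖) := fun n t => by
    rw [abs_of_nonneg (by positivity)]
    nlinarith [mul_le_mul_of_nonneg_left (hbound n (v t)) (norm_nonneg (D t))]
  have δi : ∀ n, Integrable (fun t => ‖D t‖ * ‖S n (T (v t)) - v t‖) μ := fun n =>
    Integrable.mono' ((hD.norm.integrable_mul hv.norm).const_mul 2) (δm n)
      (ae_of_all _ fun t => δb n t)
  have hδ0 : Tendsto δ atTop (𝓝 0) := by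
    have := dominated _ δm ⟨2, δb⟩ (fun _ => 0) fun t => by
      have := ((S4 (v t)).sub_const (v t)).norm.const_mul ‖D t‖
      simpa using this
    simpa using this
  -- `W` represents the function with values in `V'`, and `S n` maps it back towards `V`. Each `w n`
  -- is continuous into `H`, and where `W t = T (v t)` it converges to `ι (v t)`.
  set w : ℕ → ℝ → H := fun n t => ι (S n (W t)) with hw
  have energy : ∀ n m, ∀ t ∈ Icc 0 τ, ∀ s ∈ Icc 0 τ,
      ‖w n t - w m t‖ ^ 2 ≤ ‖w n s - w m s‖ ^ 2 + 8 * (δ n + δ m) := by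
    intro n m
    set A := S n - S m with hA
    have hAx : ∀ x, A x = S n x - S m x := fun _ => rfl
    have A1 : ∀ x y, ⟪A x, y⟫_ℝ = ⟪x, A y⟫_ℝ := fun x y => by
      simp [hAx, inner_sub_left, inner_sub_right, S1]
    -- With this symmetric `Q` the form `⟪W, QW⟫` is `‖ιAW‖²`, so the energy identity applies to `w
    -- n - w m`. In the integrand `A T` is applied twice to `v`: one factor is bounded by `2`, the
    -- other gives the regularisation errors.
    set Q := A.comp (T.comp A) with hQ
    have hQx : ∀ x, Q x = A (T (A x)) := fun _ => rfl
    have Qs : ∀ x y, ⟪Q x, y⟫_ℝ = ⟪x, Q y⟫_ℝ := fun x y => by simp [hQx, A1, hTs]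
    have hE : ∀ t, ‖w n t - w m t‖ ^ 2 = ⟪W t, Q (W t)⟫_ℝ := fun t => by
      rw [hQx, ← A1, ← hTi, real_inner_self_eq_norm_sq, hAx, map_sub]
    have hb : ∀ᵐ t ∂μ, ‖⟪D t, Q (W t)⟫_ℝ‖ ≤ 2 * (‖D t‖ * ‖S n (T (v t)) - v t‖ +
        ‖D t‖ * ‖S m (T (v t)) - v t‖) := by
      filter_upwards [hc] with t ht
      rw [ht, hQx]
      refine (norm_inner_le_norm _ _).trans ?_
      have b1 : ∀ x, ‖A (T x)‖ ≤ 2 * ‖x‖ := fun x => by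
        rw [hAx]; linarith [norm_sub_le (S n (T x)) (S m (T x)), S3 n x, S3 m x]
      have b2 : ‖A (T (v t))‖ ≤ ‖S n (T (v t)) - v t‖ + ‖S m (T (v t)) - v t‖ := by
        rw [hAx, ← sub_sub_sub_cancel_right _ _ (v t)]; exact norm_sub_le _ _
      have b3 := b1 (A (T (v t)))
      have b4 := mul_le_mul_of_nonneg_left (b3.trans (mul_le_mul_of_nonneg_left b2 zero_le_two))
        (norm_nonneg (D t))
      linarith
    have bi : Integrable (fun t => 2 * (‖D t‖ * ‖S n (T (v t)) - v t‖ +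
        ‖D t‖ * ‖S m (T (v t)) - v t‖)) μ := ((δi n).add (δi m)).const_mul 2
    have ki : Integrable (fun t => ⟪D t, Q (W t)⟫_ℝ) μ := by
      refine bi.mono' ?_ hb
      exact dI.1.inner (Q.continuous.comp_aestronglyMeasurable
        ((hWc.mono Ioo_subset_Icc_self).aestronglyMeasurable measurableSet_Ioo))
    have hI : ∀ t ∈ Icc 0 τ, |∫ r in (0:ℝ)..t, ⟪D r, Q (W r)⟫_ℝ| ≤ 2 * (δ n + δ m) := by
      intro t ht
      rw [intervalIntegral.integral_of_le ht.1, integral_Ioc_eq_integral_Ioo]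
      have hsub : Ioo 0 t ⊆ Ioo 0 τ := Ioo_subset_Ioo_right ht.2
      calc |∫ r in Ioo 0 t, ⟪D r, Q (W r)⟫_ℝ| ≤ ∫ r in Ioo 0 t, ‖⟪D r, Q (W r)⟫_ℝ‖ :=
            norm_integral_le_integral_norm (fun r => ⟪D r, Q (W r)⟫_ℝ)
        _ ≤ ∫ r in Ioo 0 τ, ‖⟪D r, Q (W r)⟫_ℝ‖ :=
            setIntegral_mono_set ki.norm (ae_of_all _ fun _ => norm_nonneg _)
              (Filter.Eventually.of_forall hsub)
        _ ≤ ∫ r in Ioo 0 τ, 2 * (‖D r‖ * ‖S n (T (v r)) - v r‖ +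
              ‖D r‖ * ‖S m (T (v r)) - v r‖) := integral_mono_ae ki.norm bi hb
        _ = 2 * (δ n + δ m) := by rw [integral_const_mul, integral_add (δi n) (δi m)]
    intro t ht s hs
    rw [hE, hE, inner_prim_symm Q Qs dII c ht, inner_prim_symm Q Qs dII c hs]
    have := abs_le.1 (hI t ht)
    have := abs_le.1 (hI s hs)
    linarith
  have hpt : ∀ᵐ t ∂μ, Tendsto (fun n => w n t) atTop (𝓝 (ι (v t))) := by
    filter_upwards [hc] with t ht
    simp only [hw, ht]
    exact (ι.continuous.tendsto _).comp (S4 (v t))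
  have hne : (ae μ).NeBot := by
    rw [ae_neBot, hμ, Ne, Measure.restrict_eq_zero, Real.volume_Ioo]
    simpa using hτ
  -- One point of convergence is enough: the energy estimate carries the Cauchy property from `s`
  -- uniformly to the whole interval.
  obtain ⟨s, hs, hsm⟩ := (hpt.and (ae_restrict_mem measurableSet_Ioo)).exists
  have hcau : UniformCauchySeqOn w atTop (Icc 0 τ) := by
    rw [Metric.uniformCauchySeqOn_iff]
    intro ε hε
    have e1 := hs.cauchySeq
    rw [Metric.cauchySeq_iff] at e1
    obtain ⟨N1, hN1⟩ := e1 (ε / 2) (half_pos hε)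
    obtain ⟨N2, hN2⟩ := (hδ0.eventually (gt_mem_nhds (show (0:ℝ) < ε ^ 2 / 32 by positivity))
      ).exists_forall_of_atTop
    refine ⟨max N1 N2, fun m hm n hn t ht => ?_⟩
    have a1 := hN1 m (le_of_max_le_left hm) n (le_of_max_le_left hn)
    have a2 := hN2 m (le_of_max_le_right hm)
    have a3 := hN2 n (le_of_max_le_right hn)
    have a4 := energy m n t ht s (Ioo_subset_Icc_self hsm)
    rw [dist_eq_norm] at a1 ⊢
    refine lt_of_pow_lt_pow_left₀ 2 hε.le ?_
    nlinarith [norm_nonneg (w m s - w n s)]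
  have : Nonempty H := ⟨0⟩
  choose! wl hwlim using fun t (ht : t ∈ Icc 0 τ) => cauchySeq_tendsto_of_complete
    (hcau.cauchySeq ht)
  have hwn : ∀ n, ContinuousOn (w n) (Icc 0 τ) := fun n =>
    (ι.comp (S n)).continuous.comp_continuousOn hWc
  refine ⟨wl, (hcau.tendstoUniformlyOn_of_tendsto hwlim).continuousOn (Frequently.of_forall hwn),
    ?_, ?_⟩
  · filter_upwards [hpt, ae_restrict_mem measurableSet_Ioo] with t h1 h2
    exact tendsto_nhds_unique h1 (hwlim t (Ioo_subset_Icc_self h2))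
  · have lim1 : Tendsto (fun n => ‖w n τ‖ ^ 2 - ‖w n 0‖ ^ 2) atTop
        (𝓝 (‖wl τ‖ ^ 2 - ‖wl 0‖ ^ 2)) :=
      ((hwlim τ (right_mem_Icc.2 hτ.le)).norm.pow 2).sub ((hwlim 0 (left_mem_Icc.2 hτ.le)).norm.pow 2)
    -- The energy identity for a single `w n` contains `S n T` applied twice to `v`. Dominated
    -- convergence applies since each `S n T` is a contraction tending strongly to the identity.
    have lim2 : Tendsto (fun n => 2 * ∫ t in Ioo 0 τ, ⟪D t, S n (T (S n (T (v t))))⟫_ℝ) atTop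
        (𝓝 (2 * ∫ t in Ioo 0 τ, ⟪D t, v t⟫_ℝ)) := by
      refine (dominated _ (fun n => ?_) ⟨1, fun n t => ?_⟩ _ fun t => ?_).const_mul 2
      · exact hD.1.inner (((S n).comp T).continuous.comp_aestronglyMeasurable (hmeas n))
      · rw [one_mul]
        refine (abs_real_inner_le_norm _ _).trans ?_
        exact mul_le_mul_of_nonneg_left ((S3 n _).trans (S3 n _)) (norm_nonneg _)
      · refine tendsto_const_nhds.inner ?_
        have := (S4 (v t)).sub_const (v t)
        rw [sub_self] at this
        have h1 : Tendsto (fun n => S n (T (S n (T (v t)) - v t))) atTop (𝓝 0) :=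
          squeeze_zero_norm (fun n => S3 n _) (by simpa using this.norm)
        simpa using h1.add (S4 (v t))
    refine tendsto_nhds_unique lim1 (lim2.congr fun n => ?_)
    set Q := (S n).comp (T.comp (S n)) with hQ
    have hQx : ∀ x, Q x = S n (T (S n x)) := fun _ => rfl
    have Qs : ∀ x y, ⟪Q x, y⟫_ℝ = ⟪x, Q y⟫_ℝ := fun x y => by simp [hQx, S1, hTs]
    have hE : ∀ t, ‖w n t‖ ^ 2 = ⟪W t, Q (W t)⟫_ℝ := fun t => by
      rw [hQx, ← S1, ← hTi, real_inner_self_eq_norm_sq]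
    rw [hE, hE, inner_prim_symm Q Qs dII c (right_mem_Icc.2 hτ.le), hW, prim_zero,
      add_sub_cancel_left, ← integral_Ioo_eq_intervalIntegral hτ.le]
    congr 1
    refine integral_congr_ae ?_
    filter_upwards [hc] with t ht
    rw [← hW, ht, hQx]

end Energy
/-! ### The multiplication operator of a real form -/

section RealForm

variable {V : Type*} [NormedAddCommGroup V] [InnerProductSpace ℝ V] {τ : ℝ}

/-- A real non-autonomous form with bound `M` and coercivity constant `α`. -/
structure IsRealForm (τ M α : ℝ) (b : ℝ → V →ₗ[ℝ] V →ₗ[ℝ] ℝ) : Prop where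
  measurable : ∀ v w, AEStronglyMeasurable (fun t => b t v w) (volume.restrict (Ioo 0 τ))
  nonneg : 0 ≤ M
  bounded : ∀ t ∈ Ioo 0 τ, ∀ v w, |b t v w| ≤ M * ‖v‖ * ‖w‖
  pos : 0 < α
  coercive : ∀ t ∈ Ioo 0 τ, ∀ v, α * ‖v‖ ^ 2 ≤ b t v v

/-- Weak measurability suffices: linearity gives the claim for simple functions, and continuity of
`β t` passes to the limit. No separability of `V` is needed. -/
theorem aestronglyMeasurable_linear_apply {Ω : Type*} [MeasurableSpace Ω] {μ : Measure Ω}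
    {β : Ω → V →ₗ[ℝ] ℝ} (hm : ∀ v, AEStronglyMeasurable (fun t => β t v) μ)
    (hc : ∀ᵐ t ∂μ, Continuous (β t)) {u : Ω → V} (hu : AEStronglyMeasurable u μ) :
    AEStronglyMeasurable (fun t => β t (u t)) μ := by
  obtain ⟨u', hu', e⟩ := hu
  have h1 : ∀ s : SimpleFunc Ω V, AEStronglyMeasurable (fun t => β t (s t)) μ := by
    intro s
    induction s using SimpleFunc.induction with
    | const c hs =>
      rename_i S
      refine ((hm c).indicator hs).congr (ae_of_all _ fun t => ?_)
      by_cases ht : t ∈ S <;> simp [ht]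
    | add _ h1 h2 =>
      refine (h1.add h2).congr (ae_of_all _ fun t => ?_)
      simp
  have h2 : AEStronglyMeasurable (fun t => β t (u' t)) μ := by
    refine aestronglyMeasurable_of_tendsto_ae atTop (fun n => h1 (hu'.approx n)) ?_
    filter_upwards [hc] with t ht
    exact (ht.tendsto _).comp (hu'.tendsto_approx t)
  refine h2.congr ?_
  filter_upwards [e] with t ht
  rw [ht]

variable {M α : ℝ} {b : ℝ → V →ₗ[ℝ] V →ₗ[ℝ] ℝ}

theorem IsRealForm.aestronglyMeasurable (hb : IsRealForm τ M α b) {u w : ℝ → V}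
    (hu : AEStronglyMeasurable u (volume.restrict (Ioo 0 τ)))
    (hw : AEStronglyMeasurable w (volume.restrict (Ioo 0 τ))) :
    AEStronglyMeasurable (fun t => b t (u t) (w t)) (volume.restrict (Ioo 0 τ)) := by
  refine aestronglyMeasurable_linear_apply (β := fun t => b t (u t)) (fun x => ?_) ?_ hw
  · refine aestronglyMeasurable_linear_apply (β := fun t => (b t).flip x)
      (fun y => hb.measurable y x) ?_ hu
    filter_upwards [ae_restrict_mem measurableSet_Ioo] with t ht
    exact AddMonoidHomClass.continuous_of_bound _ (M * ‖x‖) fun y => by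
      simpa [mul_right_comm] using hb.bounded t ht y x
  · filter_upwards [ae_restrict_mem measurableSet_Ioo] with t ht
    exact AddMonoidHomClass.continuous_of_bound _ (M * ‖u t‖) fun y => hb.bounded t ht _ y

theorem IsRealForm.norm_le (hb : IsRealForm τ M α b) (u w : ℝ → V) :
    ∀ᵐ t ∂(volume.restrict (Ioo 0 τ)), ‖b t (u t) (w t)‖ ≤ M * (‖u t‖ * ‖w t‖) := by
  filter_upwards [ae_restrict_mem measurableSet_Ioo] with t ht
  rw [← mul_assoc]; exact hb.bounded t ht _ _

theorem IsRealForm.integrable (hb : IsRealForm τ M α b) (u w : L2 τ V) :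
    Integrable (fun t => b t (u t) (w t)) (volume.restrict (Ioo 0 τ)) :=
  (((Lp.memLp u).norm.integrable_mul (Lp.memLp w).norm).const_mul M).mono'
    (hb.aestronglyMeasurable (Lp.aestronglyMeasurable u) (Lp.aestronglyMeasurable w))
    (hb.norm_le u w)

theorem integral_norm_mul_norm_le {Ω E F : Type*} [MeasurableSpace Ω] {μ : Measure Ω}
    [NormedAddCommGroup E] [NormedAddCommGroup F] (u : Lp E 2 μ) (w : Lp F 2 μ) :
    ∫ t, ‖u t‖ * ‖w t‖ ∂μ ≤ ‖u‖ * ‖w‖ := by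
  have h := real_inner_le_norm ((Lp.memLp w).norm.toLp _) ((Lp.memLp u).norm.toLp _)
  rw [L2.inner_def, Lp.norm_toLp, Lp.norm_toLp, eLpNorm_norm, eLpNorm_norm, mul_comm] at h
  refine le_trans (le_of_eq (integral_congr_ae ?_)) h
  filter_upwards [(Lp.memLp u).norm.coeFn_toLp, (Lp.memLp w).norm.coeFn_toLp] with t h1 h2
  rw [h1, h2]; rfl

/-- For non-separable `V` the function `t ↦ 𝒜(t)u(t)` may fail to be strongly measurable, so the
operator is obtained by Riesz representation in `L²(0, τ; V)` instead of pointwise. -/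
theorem IsRealForm.exists_operator [CompleteSpace V] (hb : IsRealForm τ M α b) :
    ∃ A : L2 τ V →L[ℝ] L2 τ V, ∀ u w : L2 τ V, ⟪A u, w⟫_ℝ = ∫ t in Ioo 0 τ, b t (u t) (w t) := by
  let B : L2 τ V →ₗ[ℝ] L2 τ V →ₗ[ℝ] ℝ := LinearMap.mk₂ ℝ
    (fun u w => ∫ t in Ioo 0 τ, b t (u t) (w t))
    (fun u u' w => by
      rw [← integral_add (hb.integrable u w) (hb.integrable u' w)]
      refine integral_congr_ae ?_
      filter_upwards [Lp.coeFn_add u u'] with t ht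
      rw [ht]; simp)
    (fun c u w => by
      rw [smul_eq_mul, ← integral_const_mul]
      refine integral_congr_ae ?_
      filter_upwards [Lp.coeFn_smul c u] with t ht
      rw [ht]; simp)
    (fun u w w' => by
      rw [← integral_add (hb.integrable u w) (hb.integrable u w')]
      refine integral_congr_ae ?_
      filter_upwards [Lp.coeFn_add w w'] with t ht
      rw [ht]; simp)
    (fun c u w => by
      rw [smul_eq_mul, ← integral_const_mul]
      refine integral_congr_ae ?_
      filter_upwards [Lp.coeFn_smul c w] with t ht
      rw [ht]; simp)
  have hB : ∀ u w, ‖B u w‖ ≤ M * ‖u‖ * ‖w‖ := fun u w => by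
    calc ‖∫ t in Ioo 0 τ, b t (u t) (w t)‖ ≤ ∫ t in Ioo 0 τ, M * (‖u t‖ * ‖w t‖) :=
          norm_integral_le_of_norm_le
            (((Lp.memLp u).norm.integrable_mul (Lp.memLp w).norm).const_mul M) (hb.norm_le u w)
      _ ≤ M * ‖u‖ * ‖w‖ := by
          rw [integral_const_mul, mul_assoc]
          exact mul_le_mul_of_nonneg_left (integral_norm_mul_norm_le u w) hb.nonneg
  let B' : L2 τ V →L[ℝ] L2 τ V →L[ℝ] ℝ := B.mkContinuous₂ M hB
  exact ⟨InnerProductSpace.continuousLinearMapOfBilin (𝕜 := ℝ) B', fun u w =>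
    InnerProductSpace.continuousLinearMapOfBilin_apply (𝕜 := ℝ) B' u w⟩

/-- If `G` represents the functional `w ↦ ∫ b(t, v(t), w(t)) dt`, then it does so pointwise. -/
theorem IsRealForm.ae_inner_eq (hb : IsRealForm τ M α b) {v G : L2 τ V}
    (h : ∀ w : L2 τ V, ⟪G, w⟫_ℝ = ∫ t in Ioo 0 τ, b t (v t) (w t)) (x : V) :
    ∀ᵐ t ∂(volume.restrict (Ioo 0 τ)), ⟪G t, x⟫_ℝ = b t (v t) x := by
  have i1 : Integrable (fun t => ⟪G t, x⟫_ℝ) (volume.restrict (Ioo 0 τ)) :=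
    ((Lp.memLp G).integrable one_le_two).inner_const x
  have i2 : Integrable (fun t => b t (v t) x) (volume.restrict (Ioo 0 τ)) := by
    refine (((Lp.memLp v).integrable one_le_two).norm.const_mul (M * ‖x‖)).mono'
      (hb.aestronglyMeasurable (Lp.aestronglyMeasurable v) aestronglyMeasurable_const) ?_
    filter_upwards [hb.norm_le v fun _ => x] with t ht
    linarith
  refine Integrable.ae_eq_of_forall_setIntegral_eq _ _ i1 i2 fun S hS hμS => ?_
  -- Testing with `x` times indicators of measurable sets localises the identity in time.
  have e := h (indicatorConstLp 2 hS hμS.ne x)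
  rw [L2.inner_def] at e
  have hi := indicatorConstLp_coeFn (p := 2) (hs := hS) (hμs := hμS.ne) (c := x)
  rw [← integral_indicator hS, ← integral_indicator hS]
  convert e using 1
  · refine integral_congr_ae ?_
    filter_upwards [hi] with t ht
    rw [ht]; by_cases hh : t ∈ S <;> simp [hh]
  · refine integral_congr_ae ?_
    filter_upwards [hi] with t ht
    rw [ht]; by_cases hh : t ∈ S <;> simp [hh]

end RealForm

/-! ### Extension of functionals from the range of an operator -/

/-- The bound makes `l` vanish on the kernel of `β`, hence factor through a bounded functional on
the range, which Hahn-Banach extends. The range need not be closed. -/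
theorem exists_dual_of_bound {Y E : Type*} [AddCommGroup Y] [Module ℝ Y] [NormedAddCommGroup E]
    [NormedSpace ℝ E] (β : Y →ₗ[ℝ] E) (l : Y →ₗ[ℝ] ℝ) (C : ℝ) (h : ∀ y, |l y| ≤ C * ‖β y‖) :
    ∃ φ : E →L[ℝ] ℝ, ∀ y, φ (β y) = l y := by
  obtain ⟨s, hs⟩ := β.rangeRestrict.exists_rightInverse_of_surjective β.range_rangeRestrict
  have hs' : ∀ z, β (s z) = z := fun z => congrArg Subtype.val (LinearMap.congr_fun hs z)
  let ψ : LinearMap.range β →L[ℝ] ℝ := (l.comp s).mkContinuous C fun z => by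
    have := h (s z)
    rwa [hs'] at this
  obtain ⟨φ, hφ, -⟩ := exists_extension_norm_eq (LinearMap.range β) ψ
  refine ⟨φ, fun y => ?_⟩
  rw [hφ ⟨β y, y, rfl⟩]
  change l (s ⟨β y, y, rfl⟩) = l y
  have := h (s ⟨β y, y, rfl⟩ - y)
  rw [map_sub, map_sub, hs', sub_self, norm_zero, mul_zero] at this
  exact sub_eq_zero.1 (abs_nonpos_iff.1 this)

/-! ### Primitives of functions in `L²(0, τ; V)` -/

section PrimL2

variable {V : Type*} [NormedAddCommGroup V] [NormedSpace ℝ V] {τ : ℝ}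

theorem prim_congr {c : V} {f g : ℝ → V} (h : f =ᵐ[volume.restrict (Ioo 0 τ)] g) {t : ℝ}
    (ht : t ∈ Icc 0 τ) : prim c f t = prim c g t := by
  simp only [prim]
  rw [← integral_Ioo_eq_intervalIntegral ht.1, ← integral_Ioo_eq_intervalIntegral ht.1]
  congr 1
  exact integral_congr_ae (ae_restrict_of_ae_restrict_of_subset (Ioo_subset_Ioo_right ht.2) h)

omit [NormedSpace ℝ V] in
theorem L2.intervalIntegrable (hτ : 0 ≤ τ) (g : L2 τ V) : IntervalIntegrable g volume 0 τ :=
  intervalIntegrable_of_integrable_Ioo hτ ((Lp.memLp g).integrable one_le_two)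

omit [NormedSpace ℝ V] in
theorem ContinuousOn.memLp_Ioo {f : ℝ → V} (hf : ContinuousOn f (Icc 0 τ)) :
    MemLp f 2 (volume.restrict (Ioo 0 τ)) := by
  obtain ⟨C, hC⟩ := isCompact_Icc.exists_bound_of_continuousOn hf
  refine MemLp.of_bound ((hf.mono Ioo_subset_Icc_self).aestronglyMeasurable measurableSet_Ioo) C ?_
  filter_upwards [ae_restrict_mem measurableSet_Ioo] with t ht
  exact hC t (Ioo_subset_Icc_self ht)

theorem prim_add (x x' : V) (g g' : L2 τ V) {t : ℝ} (ht : t ∈ Icc 0 τ) :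
    prim (x + x') (g + g' : L2 τ V) t = prim x g t + prim x' g' t := by
  have hsub : uIcc 0 t ⊆ uIcc 0 τ := by
    rw [uIcc_of_le ht.1, uIcc_of_le (ht.1.trans ht.2)]; exact Icc_subset_Icc_right ht.2
  rw [prim_congr (Lp.coeFn_add g g') ht]
  simp only [prim, Pi.add_apply]
  have h0 := ht.1.trans ht.2
  rw [intervalIntegral.integral_add ((L2.intervalIntegrable h0 g).mono_set hsub)
    ((L2.intervalIntegrable h0 g').mono_set hsub)]
  abel

theorem prim_smul (r : ℝ) (x : V) (g : L2 τ V) {t : ℝ} (ht : t ∈ Icc 0 τ) :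
    prim (r • x) (r • g : L2 τ V) t = r • prim x g t := by
  rw [prim_congr (Lp.coeFn_smul r g) ht]
  simp only [prim, Pi.smul_apply, intervalIntegral.integral_smul, smul_add]

theorem prim_memLp (hτ : 0 ≤ τ) (x : V) (g : L2 τ V) :
    MemLp (prim x g) 2 (volume.restrict (Ioo 0 τ)) :=
  ContinuousOn.memLp_Ioo (prim_continuousOn hτ x (L2.intervalIntegrable hτ g))

/-- The element of `L²(0, τ; V)` given by the primitive of `g` with initial value `x`. -/
noncomputable def primL2 (hτ : 0 ≤ τ) : V × L2 τ V →ₗ[ℝ] L2 τ V where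
  toFun y := (prim_memLp hτ y.1 y.2).toLp
  map_add' y z := by
    refine Lp.ext ?_
    filter_upwards [(prim_memLp hτ (y + z).1 (y + z).2).coeFn_toLp,
      Lp.coeFn_add (prim_memLp hτ y.1 y.2).toLp (prim_memLp hτ z.1 z.2).toLp,
      (prim_memLp hτ y.1 y.2).coeFn_toLp, (prim_memLp hτ z.1 z.2).coeFn_toLp,
      ae_restrict_mem measurableSet_Ioo] with t h1 h2 h3 h4 h5
    rw [h1, h2, Pi.add_apply, h3, h4]
    exact prim_add _ _ _ _ (Ioo_subset_Icc_self h5)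
  map_smul' r y := by
    refine Lp.ext ?_
    filter_upwards [(prim_memLp hτ (r • y).1 (r • y).2).coeFn_toLp,
      Lp.coeFn_smul r (prim_memLp hτ y.1 y.2).toLp,
      (prim_memLp hτ y.1 y.2).coeFn_toLp, ae_restrict_mem measurableSet_Ioo] with t h1 h2 h3 h5
    simp only [RingHom.id_apply]
    rw [h1, h2, Pi.smul_apply, h3]
    exact prim_smul _ _ _ (Ioo_subset_Icc_self h5)

theorem coeFn_primL2 (hτ : 0 ≤ τ) (y : V × L2 τ V) :
    primL2 hτ y =ᵐ[volume.restrict (Ioo 0 τ)] prim y.1 y.2 :=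
  (prim_memLp hτ y.1 y.2).coeFn_toLp

/-- The final value of the primitive of `g` with initial value `x`. -/
noncomputable def primEnd (hτ : 0 ≤ τ) : V × L2 τ V →ₗ[ℝ] V where
  toFun y := prim y.1 y.2 τ
  map_add' _ _ := prim_add _ _ _ _ (right_mem_Icc.2 hτ)
  map_smul' _ _ := prim_smul _ _ _ (right_mem_Icc.2 hτ)

end PrimL2
/-! ### Existence for the time boundary value problem -/

section Existence

variable {V : Type*} [NormedAddCommGroup V] [InnerProductSpace ℝ V] [CompleteSpace V]
  {H : Type*} [NormedAddCommGroup H] [InnerProductSpace ℝ H] [CompleteSpace H]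
  {τ M α : ℝ} {b : ℝ → V →ₗ[ℝ] V →ₗ[ℝ] ℝ}

/-- The operator `ι†ι` on `L²(0, τ; V)`. -/
noncomputable def gramL2 (τ : ℝ) (ι : V →L[ℝ] H) : L2 τ V →L[ℝ] L2 τ V :=
  (ι.adjoint.comp ι).compLpL 2 (volume.restrict (Ioo 0 τ))

theorem coeFn_gramL2 (ι : V →L[ℝ] H) (v : L2 τ V) :
    gramL2 τ ι v =ᵐ[volume.restrict (Ioo 0 τ)] fun t => ι.adjoint (ι (v t)) :=
  (ι.adjoint.comp ι).coeFn_compLpL v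

theorem gramL2_inner (ι : V →L[ℝ] H) (v w : L2 τ V) :
    ⟪gramL2 τ ι v, w⟫_ℝ = ∫ t in Ioo 0 τ, ⟪ι (v t), ι (w t)⟫_ℝ := by
  rw [L2.inner_def]
  refine integral_congr_ae ?_
  filter_upwards [coeFn_gramL2 ι v] with t ht
  rw [ht, ContinuousLinearMap.adjoint_inner_left]

/-- This is the product rule for the weight `1 - μt` and the scalar function `‖ι W(t)‖²`, where `W`
is the primitive of `y.2`. The latter is itself a primitive, by the energy identity for `ι†ι`. -/
theorem weighted_energy (hτ : 0 < τ) (ι : V →L[ℝ] H) (μ : ℝ) (y : V × L2 τ V) {Wρ : L2 τ V}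
    (hWρ : Wρ =ᵐ[volume.restrict (Ioo 0 τ)] fun t => (1 - μ * t) • prim y.1 y.2 t) :
    (1 - μ * τ) * ‖ι (prim y.1 y.2 τ)‖ ^ 2 - ‖ι y.1‖ ^ 2 =
      -μ * ⟪gramL2 τ ι (primL2 hτ.le y), primL2 hτ.le y⟫_ℝ + 2 * ⟪gramL2 τ ι y.2, Wρ⟫_ℝ := by
  obtain ⟨x, g⟩ := y
  simp only at hWρ ⊢
  set T : V →L[ℝ] V := ι.adjoint.comp ι with hT
  have hTi : ∀ x y, ⟪ι x, ι y⟫_ℝ = ⟪x, T y⟫_ℝ := fun x y => by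
    rw [hT, ContinuousLinearMap.comp_apply, ContinuousLinearMap.adjoint_inner_right]
  have hTs : ∀ x y, ⟪T x, y⟫_ℝ = ⟪x, T y⟫_ℝ := fun x y => by
    rw [← hTi, real_inner_comm, ← hTi, real_inner_comm]
  have gI := L2.intervalIntegrable hτ.le g
  have hwc := prim_continuousOn hτ.le x gI
  set k : ℝ → ℝ := fun r => 2 * ⟪g r, T (prim x g r)⟫_ℝ with hk
  have kI : IntervalIntegrable k volume 0 τ := by
    have := intervalIntegrable_bilin_left (innerSL ℝ : V →L[ℝ] V →L[ℝ] ℝ) hτ.le gI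
      (T.continuous.comp_continuousOn hwc)
    exact this.const_mul 2
  have hN : ∀ t ∈ Icc 0 τ, prim (‖ι x‖ ^ 2) k t = ‖ι (prim x g t)‖ ^ 2 := fun t ht => by
    rw [← real_inner_self_eq_norm_sq (ι (prim x g t)), hTi, inner_prim_symm T hTs gI x ht,
      prim, hk, intervalIntegral.integral_const_mul, ← hTi, real_inner_self_eq_norm_sq]
  have hρ : ∀ t, prim 1 (fun _ => -μ) t = 1 - μ * t := fun t => by
    simp [prim]; ring
  have key := bilin_prim_sub (ContinuousLinearMap.mul ℝ ℝ) (f := fun _ => -μ)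
    (intervalIntegrable_const) kI 1 (‖ι x‖ ^ 2) (right_mem_Icc.2 hτ.le)
  simp only [ContinuousLinearMap.mul_apply', hρ, hN τ (right_mem_Icc.2 hτ.le)] at key
  rw [key, prim, one_mul, add_sub_cancel_left, ← integral_Ioo_eq_intervalIntegral hτ.le,
    L2.inner_def, L2.inner_def, ← integral_const_mul, ← integral_const_mul,
    ← integral_add ((L2.integrable_inner _ _).const_mul _) ((L2.integrable_inner _ _).const_mul _)]
  refine integral_congr_ae ?_
  filter_upwards [hWρ, coeFn_gramL2 ι g, coeFn_gramL2 ι (primL2 hτ.le (x, g)),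
    coeFn_primL2 hτ.le (x, g), ae_restrict_mem measurableSet_Ioo] with t h1 h2 h3 h4 h5
  rw [h1, h2, h3, h4, hN t (Ioo_subset_Icc_self h5), hk]
  simp only
  rw [ContinuousLinearMap.adjoint_inner_left, ContinuousLinearMap.adjoint_inner_left,
    real_inner_self_eq_norm_sq, map_smul, real_inner_smul_right, hTi]
  ring

/-- Coercivity of the time boundary value problem on primitives, tested with a weight. -/
theorem weighted_coercivity (hτ : 0 < τ) (ι : V →L[ℝ] H) {Φ : H →L[ℝ] H} (hΦ : ‖Φ‖ ≤ 1)
    (hb : IsRealForm τ M α b) {A : L2 τ V →L[ℝ] L2 τ V}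
    (hA : ∀ u w : L2 τ V, ⟪A u, w⟫_ℝ = ∫ t in Ioo 0 τ, b t (u t) (w t)) {l p : ℝ} (hl : 0 < l)
    (hp : p = 1 / (1 + 2 * l * τ)) (y : V × L2 τ V) {W : L2 τ V} (hW : W = primL2 hτ.le y)
    {e : H} (he : e = ι (primEnd hτ.le y)) :
    p * α * ‖W‖ ^ 2 + p * (1 - p) / 2 * ‖e‖ ^ 2 ≤
      ‖-gramL2 τ ι y.2 + l • gramL2 τ ι W + A.adjoint W‖ * ‖W‖ +
        p * (‖e - Φ.adjoint (ι y.1)‖ * ‖e‖) := by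
  have hden : 0 < 1 + 2 * l * τ := by positivity
  have hp0 : 0 < p := by rw [hp]; positivity
  -- The weight falls from `1` to `p`, so `1 - μτ = p`. The relation `μ = 2lp` makes the term `-μ
  -- ⟪TW, W⟫` from the energy identity cancel against the lower bound `lp ⟪TW, W⟫` for `l ⟪TW, Wρ⟫`.
  set μ := 2 * l * p with hμ
  have hμ0 : 0 < μ := by positivity
  have hpμ : 1 - μ * τ = p := by rw [hμ, hp]; field_simp; ring
  have hρ : ∀ t ∈ Ioo 0 τ, p ≤ 1 - μ * t ∧ 1 - μ * t ≤ 1 := fun t ht => by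
    constructor
    · rw [← hpμ]; nlinarith [ht.2]
    · nlinarith [ht.1]
  have hWρm : MemLp (fun t => (1 - μ * t) • prim y.1 y.2 t) 2 (volume.restrict (Ioo 0 τ)) :=
    ContinuousOn.memLp_Ioo ((by fun_prop : Continuous fun t => 1 - μ * t).continuousOn.smul
      (prim_continuousOn hτ.le _ (L2.intervalIntegrable hτ.le _)))
  set Wρ : L2 τ V := hWρm.toLp with hWρ
  have eρ := hWρm.coeFn_toLp
  have eW := coeFn_primL2 hτ.le y
  rw [← hW] at eW
  have eρW : Wρ =ᵐ[volume.restrict (Ioo 0 τ)] fun t => (1 - μ * t) • W t := by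
    filter_upwards [eρ, eW] with t h1 h2
    rw [h1, h2]
  have hnorm : ‖Wρ‖ ≤ ‖W‖ := by
    refine Lp.norm_le_norm_of_ae_le ?_
    filter_upwards [eρW, ae_restrict_mem measurableSet_Ioo] with t h1 h2
    rw [h1, norm_smul, Real.norm_of_nonneg (hp0.le.trans (hρ t h2).1)]
    exact mul_le_of_le_one_left (norm_nonneg _) (hρ t h2).2
  have E := weighted_energy hτ ι μ y eρ
  rw [hpμ, ← hW] at E
  have he' : e = ι (prim y.1 y.2 τ) := he
  rw [← he'] at E
  have F1 : p * ⟪gramL2 τ ι W, W⟫_ℝ ≤ ⟪gramL2 τ ι W, Wρ⟫_ℝ := by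
    rw [L2.inner_def, L2.inner_def, ← integral_const_mul]
    refine integral_mono_ae ((L2.integrable_inner _ _).const_mul _) (L2.integrable_inner _ _) ?_
    filter_upwards [eρW, coeFn_gramL2 ι W, ae_restrict_mem measurableSet_Ioo] with t h1 h2 h3
    rw [h1, h2, real_inner_smul_right, ContinuousLinearMap.adjoint_inner_left]
    exact mul_le_mul_of_nonneg_right (hρ t h3).1 real_inner_self_nonneg
  have F2 : p * α * ‖W‖ ^ 2 ≤ ⟪A.adjoint W, Wρ⟫_ℝ := by
    rw [ContinuousLinearMap.adjoint_inner_left, real_inner_comm, hA, ← real_inner_self_eq_norm_sq,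
      L2.inner_def, ← integral_const_mul]
    refine integral_mono_ae ((L2.integrable_inner _ _).const_mul _) (hb.integrable _ _) ?_
    filter_upwards [eρW, ae_restrict_mem measurableSet_Ioo] with t h1 h3
    rw [h1, map_smul, LinearMap.smul_apply, smul_eq_mul, real_inner_self_eq_norm_sq, mul_assoc]
    have := hb.coercive t h3 (W t)
    exact mul_le_mul (hρ t h3).1 this (by have := hb.pos; positivity) (hp0.le.trans (hρ t h3).1)
  have F3 := (real_inner_le_norm (-gramL2 τ ι y.2 + l • gramL2 τ ι W + A.adjoint W) Wρ).trans
    (mul_le_mul_of_nonneg_left hnorm (norm_nonneg _))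
  rw [inner_add_left, inner_add_left, inner_neg_left, real_inner_smul_left] at F3
  have F4 := real_inner_le_norm (e - Φ.adjoint (ι y.1)) e
  rw [inner_sub_left, real_inner_self_eq_norm_sq, ContinuousLinearMap.adjoint_inner_left] at F4
  have F5 : ⟪ι y.1, Φ e⟫_ℝ ≤ ‖ι y.1‖ * ‖e‖ :=
    (real_inner_le_norm _ _).trans (mul_le_mul_of_nonneg_left
      ((Φ.le_of_opNorm_le hΦ e).trans_eq (one_mul _)) (norm_nonneg _))
  have F6 := mul_le_mul_of_nonneg_left F1 hl.le
  have F7 : p * (‖e‖ ^ 2 - ‖ι y.1‖ * ‖e‖) ≤ p * (‖e - Φ.adjoint (ι y.1)‖ * ‖e‖) :=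
    mul_le_mul_of_nonneg_left (by linarith) hp0.le
  -- The boundary terms add up to `‖ιx‖²/2 - p‖ιx‖‖e‖ + p‖e‖²/2` with `x = y.1`. Completing the
  -- square leaves `p(1 - p)/2 ‖e‖²`, positive because the weight has `p < 1`.
  nlinarith [sq_nonneg (‖ι y.1‖ - p * ‖e‖)]

/-- The identity says that `(v, ξ)` pairs with the adjoint data `(β1 y, β2 y)` to give `⟪F, W y⟫`.
By `weighted_coercivity` the data control `W y`, so this prescribes a bounded functional on their
range. `v` and `ξ` are the Riesz representatives of the components of an extension. -/
theorem exists_weak_solution (hτ : 0 < τ) (ι : V →L[ℝ] H) {Φ : H →L[ℝ] H} (hΦ : ‖Φ‖ ≤ 1)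
    (hb : IsRealForm τ M α b) {A : L2 τ V →L[ℝ] L2 τ V}
    (hA : ∀ u w : L2 τ V, ⟪A u, w⟫_ℝ = ∫ t in Ioo 0 τ, b t (u t) (w t)) {l : ℝ} (hl : 0 < l)
    (F : L2 τ V) :
    ∃ (v : L2 τ V) (ξ : H), ∀ y : V × L2 τ V,
      ⟪gramL2 τ ι v, y.2⟫_ℝ + ⟪F - l • gramL2 τ ι v - A v, primL2 hτ.le y⟫_ℝ =
        ⟪ξ, ι (primEnd hτ.le y)⟫_ℝ - ⟪Φ ξ, ι y.1⟫_ℝ := by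
  set p := 1 / (1 + 2 * l * τ) with hp
  have hden : 1 < 1 + 2 * l * τ := by have := mul_pos hl hτ; linarith
  have hp0 : 0 < p := by rw [hp]; positivity
  have hp1 : p < 1 := by rw [hp, div_lt_one (by linarith)]; exact hden
  let W := primL2 (V := V) hτ.le
  let e : V × L2 τ V →ₗ[ℝ] H := (ι : V →ₗ[ℝ] H).comp (primEnd hτ.le)
  let β1 : V × L2 τ V →ₗ[ℝ] L2 τ V :=
    -((gramL2 τ ι : L2 τ V →ₗ[ℝ] L2 τ V).comp (LinearMap.snd ℝ V (L2 τ V))) +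
      l • ((gramL2 τ ι : L2 τ V →ₗ[ℝ] L2 τ V).comp W) + (A.adjoint : L2 τ V →ₗ[ℝ] L2 τ V).comp W
  let β2 : V × L2 τ V →ₗ[ℝ] H := e -
    ((Φ.adjoint.comp ι : V →L[ℝ] H) : V →ₗ[ℝ] H).comp (LinearMap.fst ℝ V (L2 τ V))
  have hβ1 : ∀ y, β1 y = -gramL2 τ ι y.2 + l • gramL2 τ ι (W y) + A.adjoint (W y) := fun _ => rfl
  have hβ2 : ∀ y, β2 y = e y - Φ.adjoint (ι y.1) := fun _ => rfl
  set κ := min (p * α) (p * (1 - p) / 2) with hκ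
  have hκ0 : 0 < κ := lt_min (mul_pos hp0 hb.pos) (by have := sub_pos.2 hp1; positivity)
  obtain ⟨φ, hφ⟩ := exists_dual_of_bound (β1.prod β2)
    (((innerSL ℝ F : L2 τ V →L[ℝ] ℝ) : L2 τ V →ₗ[ℝ] ℝ).comp W) (‖F‖ * (2 / κ)) fun y => by
    have c1 := weighted_coercivity hτ ι hΦ hb hA hl hp y (W := W y) rfl (e := e y) rfl
    rw [← hβ1, ← hβ2] at c1
    have n1 : ‖β1 y‖ ≤ ‖(β1.prod β2) y‖ := le_max_left _ _
    have n2 : ‖β2 y‖ ≤ ‖(β1.prod β2) y‖ := le_max_right _ _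
    set B := ‖(β1.prod β2) y‖ with hB
    have hB0 : 0 ≤ B := norm_nonneg _
    have bound : ‖W y‖ ≤ 2 / κ * B := by
      have m1 : κ * ‖W y‖ ^ 2 ≤ p * α * ‖W y‖ ^ 2 :=
        mul_le_mul_of_nonneg_right (min_le_left _ _) (sq_nonneg _)
      have m2 : κ * ‖e y‖ ^ 2 ≤ p * (1 - p) / 2 * ‖e y‖ ^ 2 :=
        mul_le_mul_of_nonneg_right (min_le_right _ _) (sq_nonneg _)
      have m3 : ‖β1 y‖ * ‖W y‖ ≤ B * ‖W y‖ := mul_le_mul_of_nonneg_right n1 (norm_nonneg _)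
      have m4 : ‖β2 y‖ * ‖e y‖ ≤ B * ‖e y‖ := mul_le_mul_of_nonneg_right n2 (norm_nonneg _)
      have m5 : p * (‖β2 y‖ * ‖e y‖) ≤ B * ‖e y‖ :=
        (mul_le_of_le_one_left (by positivity) hp1.le).trans m4
      have m6 : κ * (‖W y‖ ^ 2 + ‖e y‖ ^ 2) ≤ B * (‖W y‖ + ‖e y‖) := by linarith
      have m7 : κ * (‖W y‖ + ‖e y‖) * (‖W y‖ + ‖e y‖) ≤ 2 * B * (‖W y‖ + ‖e y‖) := by
        nlinarith [mul_nonneg hκ0.le (sq_nonneg (‖W y‖ - ‖e y‖))]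
      rw [div_mul_eq_mul_div, le_div_iff₀ hκ0]
      rcases (norm_nonneg (W y)).eq_or_lt with h0 | h0
      · rw [← h0, zero_mul]; positivity
      · have := le_of_mul_le_mul_right m7 (by positivity)
        nlinarith [norm_nonneg (e y)]
    calc |⟪F, W y⟫_ℝ| ≤ ‖F‖ * ‖W y‖ := abs_real_inner_le_norm _ _
      _ ≤ ‖F‖ * (2 / κ * B) := mul_le_mul_of_nonneg_left bound (norm_nonneg _)
      _ = ‖F‖ * (2 / κ) * B := by ring
  obtain ⟨v, hv⟩ := (InnerProductSpace.toDual ℝ (L2 τ V)).surjective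
    (φ.comp (ContinuousLinearMap.inl ℝ (L2 τ V) H))
  obtain ⟨ξ, hξ⟩ := (InnerProductSpace.toDual ℝ H).surjective
    (φ.comp (ContinuousLinearMap.inr ℝ (L2 τ V) H))
  have hv' : ∀ z, ⟪v, z⟫_ℝ = φ (z, 0) := fun z => by
    rw [← InnerProductSpace.toDual_apply_apply, hv]; rfl
  have hξ' : ∀ z, ⟪ξ, z⟫_ℝ = φ (0, z) := fun z => by
    rw [← InnerProductSpace.toDual_apply_apply, hξ]; rfl
  refine ⟨v, ξ, fun y => ?_⟩
  have e1 : ⟪v, β1 y⟫_ℝ + ⟪ξ, β2 y⟫_ℝ = ⟪F, W y⟫_ℝ := by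
    rw [hv', hξ', ← map_add, Prod.mk_add_mk, add_zero, zero_add]
    exact hφ y
  have gs : ∀ u w : L2 τ V, ⟪u, gramL2 τ ι w⟫_ℝ = ⟪gramL2 τ ι u, w⟫_ℝ := fun u w => by
    rw [real_inner_comm, gramL2_inner, gramL2_inner]
    simp only [real_inner_comm]
  rw [hβ1, hβ2, inner_add_right, inner_add_right, inner_neg_right, inner_sub_right,
    real_inner_smul_right, gs, gs, ContinuousLinearMap.adjoint_inner_right,
    ContinuousLinearMap.adjoint_inner_right] at e1
  rw [inner_sub_left, inner_sub_left, real_inner_smul_left]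
  change _ + (⟪F, W y⟫_ℝ - l * ⟪gramL2 τ ι v, W y⟫_ℝ - ⟪A v, W y⟫_ℝ) = ⟪ξ, e y⟫_ℝ - _
  linarith

/-- The test pairs are `(0, φ' x)` with `x ∈ V`: their primitive is `φ x`, which vanishes at both
ends, so no boundary terms remain. -/
theorem hasWeakDeriv_of_weak_solution (hτ : 0 < τ) {K D : L2 τ V} {ξ ζ : V}
    (h : ∀ y : V × L2 τ V, ⟪K, y.2⟫_ℝ + ⟪D, primL2 hτ.le y⟫_ℝ =
      ⟪ξ, primEnd hτ.le y⟫_ℝ - ⟪ζ, y.1⟫_ℝ) : HasWeakDeriv τ K D := by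
  intro φ φd φc φs
  have cd : Continuous (deriv φ) := φd.continuous_deriv (by simp)
  have h0 : φ 0 = 0 := image_eq_zero_of_notMem_tsupport fun hh => lt_irrefl _ (φs hh).1
  have h1 : φ τ = 0 := image_eq_zero_of_notMem_tsupport fun hh => lt_irrefl _ (φs hh).2
  have i1 := integrable_smul_L2 (Lp.memLp K) cd φc.deriv
  have i2 := integrable_smul_L2 (Lp.memLp D) φd.continuous φc
  rw [eq_neg_iff_add_eq_zero, ← integral_add i1 i2]
  refine integral_eq_zero_of_forall_integral_inner_eq_zero ℝ _ (i1.add i2) fun x => ?_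
  have gm : MemLp (fun t => deriv φ t • x) 2 (volume.restrict (Ioo 0 τ)) :=
    ContinuousOn.memLp_Ioo (cd.smul continuous_const).continuousOn
  have hpr : ∀ t ∈ Icc 0 τ, prim 0 gm.toLp t = φ t • x := fun t ht => by
    rw [prim_congr gm.coeFn_toLp ht, prim, intervalIntegral.integral_smul_const,
      intervalIntegral.integral_deriv_eq_sub
        (fun s _ => (φd.differentiable (by simp)).differentiableAt)
        (cd.intervalIntegrable _ _), h0, sub_zero, zero_add]
  have e := h (0, gm.toLp)
  have hend : primEnd hτ.le ((0 : V), gm.toLp) = 0 := by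
    change prim 0 gm.toLp τ = 0
    rw [hpr τ (right_mem_Icc.2 hτ.le), h1, zero_smul]
  rw [hend, inner_zero_right, inner_zero_right, sub_zero, L2.inner_def, L2.inner_def,
    ← integral_add (L2.integrable_inner _ _) (L2.integrable_inner _ _)] at e
  refine (integral_congr_ae ?_).trans e
  filter_upwards [gm.coeFn_toLp, coeFn_primL2 hτ.le ((0 : V), gm.toLp),
    ae_restrict_mem measurableSet_Ioo] with t h2 h3 h4
  rw [h2, h3, hpr t (Ioo_subset_Icc_self h4), inner_add_right]
  simp only [real_inner_smul_right]
  rw [real_inner_comm x, real_inner_comm x]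

/-- The weak solution has a continuous representative `w`. Comparing integration by parts for `w`
with the weak identity identifies its end values as `ξ` and `Φ ξ`. -/
theorem exists_solution (hτ : 0 < τ) {ι : V →L[ℝ] H} (hι : Function.Injective ι)
    (hd : DenseRange ι) {Φ : H →L[ℝ] H} (hΦ : ‖Φ‖ ≤ 1) (hb : IsRealForm τ M α b) {l : ℝ}
    (hl : 0 < l) (f : L2 τ H) :
    ∃ (v G : L2 τ V) (w : ℝ → H),
      (∀ x, ∀ᵐ t ∂(volume.restrict (Ioo 0 τ)), ⟪G t, x⟫_ℝ = b t (v t) x) ∧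
      HasWeakDeriv τ (fun t => ι.adjoint (ι (v t)))
        (fun t => ι.adjoint (f t - l • ι (v t)) - G t) ∧
      ContinuousOn w (Icc 0 τ) ∧ (fun t => ι (v t)) =ᵐ[volume.restrict (Ioo 0 τ)] w ∧
      w 0 = Φ (w τ) := by
  obtain ⟨A, hA⟩ := hb.exists_operator
  set F : L2 τ V := ι.adjoint.compLp f with hF
  obtain ⟨v, ξ, hv⟩ := exists_weak_solution hτ ι hΦ hb hA hl F
  set D : L2 τ V := F - l • gramL2 τ ι v - A v with hD
  have eD : D =ᵐ[volume.restrict (Ioo 0 τ)] fun t => ι.adjoint (f t - l • ι (v t)) - A v t := by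
    filter_upwards [Lp.coeFn_sub (F - l • gramL2 τ ι v) (A v), Lp.coeFn_sub F (l • gramL2 τ ι v),
      Lp.coeFn_smul l (gramL2 τ ι v), coeFn_gramL2 ι v, ι.adjoint.coeFn_compLp f]
      with t h1 h2 h3 h4 h5
    rw [hD, h1, Pi.sub_apply, h2, Pi.sub_apply, h3, Pi.smul_apply, h4, h5, map_sub, map_smul]
  have wd : HasWeakDeriv τ (gramL2 τ ι v) D :=
    hasWeakDeriv_of_weak_solution hτ (ξ := ι.adjoint ξ) (ζ := ι.adjoint (Φ ξ)) fun y => by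
      rw [hv, ContinuousLinearMap.adjoint_inner_left, ContinuousLinearMap.adjoint_inner_left]
  have wd1 := wd.congr (coeFn_gramL2 ι v) (ae_eq_refl _)
  obtain ⟨w, wc, we, -⟩ := exists_continuous_representative hτ hι (Lp.memLp v) (Lp.memLp D) wd1
  refine ⟨v, A v, w, fun x => hb.ae_inner_eq (fun w => hA v w) x,
    wd.congr (coeFn_gramL2 ι v) eD, wc, we, ?_⟩
  have DI := L2.intervalIntegrable hτ.le D
  obtain ⟨c, hc⟩ := wd.ae_eq_prim hτ ((Lp.memLp _).integrable one_le_two)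
    ((Lp.memLp _).integrable one_le_two)
  have hpw : EqOn (prim c D) (fun t => ι.adjoint (w t)) (Icc 0 τ) := by
    refine Measure.eqOn_Icc_of_ae_eq volume hτ.ne ?_ (prim_continuousOn hτ.le c DI)
      (ι.adjoint.continuous.comp_continuousOn wc)
    rw [← Measure.restrict_congr_set Ioo_ae_eq_Icc]
    filter_upwards [hc, we, coeFn_gramL2 ι v] with t h1 h2 h3
    rw [← h1, h3, h2]
  have ibp : ∀ y : V × L2 τ V, ⟪w τ, ι (prim y.1 y.2 τ)⟫_ℝ - ⟪w 0, ι y.1⟫_ℝ =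
      ⟪ξ, ι (prim y.1 y.2 τ)⟫_ℝ - ⟪Φ ξ, ι y.1⟫_ℝ := by
    intro y
    have := bilin_prim_sub (innerSL ℝ : V →L[ℝ] V →L[ℝ] ℝ) DI (L2.intervalIntegrable hτ.le y.2) c y.1
      (right_mem_Icc.2 hτ.le)
    change ⟪_, _⟫_ℝ = prim ⟪c, y.1⟫_ℝ (fun r => ⟪D r, prim y.1 y.2 r⟫_ℝ + ⟪prim c D r, y.2 r⟫_ℝ) τ at this
    refine Eq.trans ?_ (hv y)
    have c0 := hpw (left_mem_Icc.2 hτ.le)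
    have cτ := hpw (right_mem_Icc.2 hτ.le)
    rw [prim_zero] at c0
    change c = ι.adjoint (w 0) at c0
    change _ = ι.adjoint (w τ) at cτ
    rw [← ContinuousLinearMap.adjoint_inner_left, ← cτ, this, ← ContinuousLinearMap.adjoint_inner_left,
      ← c0, prim, add_sub_cancel_left, ← integral_Ioo_eq_intervalIntegral hτ.le, L2.inner_def,
      L2.inner_def, ← integral_add (L2.integrable_inner _ _) (L2.integrable_inner _ _)]
    refine integral_congr_ae ?_
    filter_upwards [hc, coeFn_primL2 hτ.le y] with t h1 h2
    rw [h1, h2, add_comm]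
  -- Affine functions realise arbitrary initial and final values independently, so density of the
  -- range of `ι` separates the two boundary terms.
  have const : ∀ x z : V, ∃ g : L2 τ V, prim x g τ = z := fun x z => by
    have gm : MemLp (fun _ => τ⁻¹ • (z - x)) 2 (volume.restrict (Ioo 0 τ)) := memLp_const _
    refine ⟨gm.toLp, ?_⟩
    rw [prim_congr gm.coeFn_toLp (right_mem_Icc.2 hτ.le), prim, intervalIntegral.integral_const,
      sub_zero, smul_smul, mul_inv_cancel₀ hτ.ne', one_smul, add_sub_cancel]
  have hτξ : w τ = ξ := by
    refine hd.eq_of_inner_left (𝕜 := ℝ) fun x => ?_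
    obtain ⟨g, hg⟩ := const 0 x
    simpa [hg] using ibp (0, g)
  have h0ξ : w 0 = Φ ξ := by
    refine hd.eq_of_inner_left (𝕜 := ℝ) fun x => ?_
    obtain ⟨g, hg⟩ := const x 0
    simpa [hg] using ibp (x, g)
  rw [h0ξ, hτξ]

end Existence
/-! ### m-accretivity in Hilbert spaces -/

/-- Positivity gives `‖x‖² ≤ Re ⟪x, x + tAx⟫`, and Cauchy-Schwarz finishes. -/
theorem isMAccretive_of_graph {𝕜 : Type*} [RCLike 𝕜] {X : Type*} [NormedAddCommGroup X]
    [InnerProductSpace 𝕜 X] (A : X →ₗ.[𝕜] X)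
    (h1 : ∀ x y : X, (x, y) ∈ A.graph → 0 ≤ RCLike.re ⟪x, y⟫_𝕜)
    (h2 : ∀ l : ℝ, 0 < l → ∀ f : X, ∃ x : X, (x, f - (l : 𝕜) • x) ∈ A.graph) :
    IsMAccretive A where
  accretive x t ht := by
    have h := h1 x (A x) (A.mem_graph x)
    have e : ‖(x : X)‖ ^ 2 ≤ RCLike.re ⟪(x : X), (x : X) + (t : 𝕜) • A x⟫_𝕜 := by
      rw [inner_add_right, inner_smul_right, map_add, RCLike.re_ofReal_mul,
        inner_self_eq_norm_sq]
      nlinarith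
    have e2 := e.trans ((RCLike.re_le_norm _).trans (norm_inner_le_norm _ _))
    rcases (norm_nonneg (x : X)).eq_or_lt with h0 | h0
    · rw [← h0]; exact norm_nonneg _
    · rw [sq] at e2; exact le_of_mul_le_mul_left e2 h0
  surjective l hl f := by
    obtain ⟨x, hx⟩ := h2 l hl f
    obtain ⟨y, hy1, hy2⟩ := A.mem_graph_iff.1 hx
    refine ⟨y, ?_⟩
    rw [hy2, hy1]; simp

/-! ### The Riesz isomorphism between `V` and its antidual -/

section Riesz

variable {𝕜 : Type*} [RCLike 𝕜] {V : Type*} [NormedAddCommGroup V] [InnerProductSpace 𝕜 V]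
  [CompleteSpace V]

theorem toAntiDual_id_bijective :
    Function.Bijective (toAntiDual (ContinuousLinearMap.id 𝕜 V)) := by
  refine ⟨(injective_iff_map_eq_zero _).2 fun x hx => ?_, fun ψ => ?_⟩
  · rw [← inner_self_eq_zero (𝕜 := 𝕜)]
    exact DFunLike.congr_fun hx x
  -- The conjugate of an antilinear functional is linear, so the usual Riesz theorem applies.
  · let l : V →L[𝕜] 𝕜 := LinearMap.mkContinuous
      { toFun := fun w => starRingEnd 𝕜 (ψ w)
        map_add' := fun x y => by simp
        map_smul' := fun c x => by simp } ‖ψ‖ fun x => by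
          simpa using ψ.le_opNorm x
    refine ⟨(InnerProductSpace.toDual 𝕜 V).symm l, ?_⟩
    ext w
    rw [toAntiDual_apply, ← inner_conj_symm]
    change starRingEnd 𝕜 ⟪(InnerProductSpace.toDual 𝕜 V).symm l, w⟫_𝕜 = ψ w
    rw [InnerProductSpace.toDual_symm_apply]
    exact RCLike.conj_conj _

/-- The Riesz isomorphism between `V` and the space of bounded antilinear functionals. -/
noncomputable def rieszAnti (𝕜 V : Type*) [RCLike 𝕜] [NormedAddCommGroup V]
    [InnerProductSpace 𝕜 V] [CompleteSpace V] : V ≃L[𝕜] (V →L⋆[𝕜] 𝕜) :=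
  ContinuousLinearEquiv.ofBijective (toAntiDual (ContinuousLinearMap.id 𝕜 V))
    (LinearMap.ker_eq_bot.2 toAntiDual_id_bijective.1)
    (LinearMap.range_eq_top.2 toAntiDual_id_bijective.2)

theorem rieszAnti_apply (x w : V) : rieszAnti 𝕜 V x w = ⟪w, x⟫_𝕜 := rfl

theorem HasWeakDeriv.map {τ : ℝ} {X Y : Type*} [NormedAddCommGroup X] [NormedSpace 𝕜 X]
    [NormedSpace ℝ X] [NormedAddCommGroup Y] [NormedSpace 𝕜 Y] [NormedSpace ℝ Y]
    [IsScalarTower ℝ 𝕜 X] [IsScalarTower ℝ 𝕜 Y] [CompleteSpace X] [CompleteSpace Y]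
    {u u' : ℝ → X} (h : HasWeakDeriv τ u u') (hu : MemLp u 2 (volume.restrict (Ioo 0 τ)))
    (hu' : MemLp u' 2 (volume.restrict (Ioo 0 τ))) (L : X →L[𝕜] Y) :
    HasWeakDeriv τ (fun t => L (u t)) (fun t => L (u' t)) := by
  intro φ φd φc φs
  have cd : Continuous (deriv φ) := φd.continuous_deriv (by simp)
  have hL : ∀ (r : ℝ) (x : X), r • L x = L (r • x) := fun r x => by
    rw [← algebraMap_smul 𝕜 r x, map_smul, algebraMap_smul]
  simp only [hL]
  rw [L.integral_comp_comm (integrable_smul_L2 hu cd φc.deriv),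
    L.integral_comp_comm (integrable_smul_L2 hu' φd.continuous φc), h φ φd φc φs, map_neg]

end Riesz

/-! ### Reduction to real scalars -/

section Restrict

variable {𝕜 : Type*} [RCLike 𝕜]
  {V : Type*} [NormedAddCommGroup V] [InnerProductSpace 𝕜 V] [CompleteSpace V]
  [InnerProductSpace ℝ V] [IsScalarTower ℝ 𝕜 V]
  {H : Type*} [NormedAddCommGroup H] [InnerProductSpace 𝕜 H] [CompleteSpace H]
  [InnerProductSpace ℝ H] [IsScalarTower ℝ 𝕜 H]

/-- This translates between the two pictures: under Riesz, the real adjoint `ι†` is the embedding of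
`H` in `V'`, since the real and the `𝕜`-adjoint agree. -/
theorem rieszAnti_adjoint_restrictScalars (hV : ∀ x y : V, ⟪x, y⟫_ℝ = RCLike.re ⟪x, y⟫_𝕜)
    (hH : ∀ x y : H, ⟪x, y⟫_ℝ = RCLike.re ⟪x, y⟫_𝕜) (ι : V →L[𝕜] H) (x : H) :
    rieszAnti 𝕜 V ((ι.restrictScalars ℝ).adjoint x) = toAntiDual ι x := by
  have : (ι.restrictScalars ℝ).adjoint x = ι.adjoint x := by
    refine ext_inner_left ℝ fun w => ?_
    rw [ContinuousLinearMap.adjoint_inner_right, hV, ContinuousLinearMap.adjoint_inner_right, hH]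
    rfl
  ext w
  rw [this, rieszAnti_apply, ContinuousLinearMap.adjoint_inner_right]
  rfl

variable {τ : ℝ}

-- The continuous representative is unique on `[0, τ]`, so the boundary condition holds for `w` as
-- well.
omit [CompleteSpace H] [InnerProductSpace ℝ H] [IsScalarTower ℝ 𝕜 H] in
theorem TimeBoundary.norm_le {Φ : H →L[𝕜] H} (hτ : 0 < τ) (hΦ : ‖Φ‖ ≤ 1) {u : L2 τ H}
    (hu : TimeBoundary τ Φ u) {w : ℝ → H} (hw : ContinuousOn w (Icc 0 τ))
    (huw : u =ᵐ[volume.restrict (Ioo 0 τ)] w) : ‖w 0‖ ^ 2 ≤ ‖w τ‖ ^ 2 := by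
  obtain ⟨z, zc, ze, zb⟩ := hu
  have : EqOn z w (Icc 0 τ) := by
    refine Measure.eqOn_Icc_of_ae_eq volume hτ.ne ?_ zc hw
    rw [← Measure.restrict_congr_set Ioo_ae_eq_Icc]
    exact ze.symm.trans huw
  rw [this (left_mem_Icc.2 hτ.le), this (right_mem_Icc.2 hτ.le)] at zb
  rw [zb]
  have := Φ.le_of_opNorm_le hΦ (w τ)
  rw [one_mul] at this
  gcongr

/-- Integration by parts for `u ∈ MR(V, V')` with `u(0) = Φ u(τ)`. -/
theorem IsMR.integral_nonneg (hV : ∀ x y : V, ⟪x, y⟫_ℝ = RCLike.re ⟪x, y⟫_𝕜)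
    (hH : ∀ x y : H, ⟪x, y⟫_ℝ = RCLike.re ⟪x, y⟫_𝕜) (hτ : 0 < τ) {ι : V →L[𝕜] H}
    (hι : Function.Injective ι) {Φ : H →L[𝕜] H} (hΦ : ‖Φ‖ ≤ 1) {u : L2 τ H} {v : L2 τ V}
    {d : L2 τ (V →L⋆[𝕜] 𝕜)} (h : IsMR τ ι u v d) (hb : TimeBoundary τ Φ u) :
    0 ≤ ∫ t in Ioo 0 τ, RCLike.re (d t (v t)) := by
  set ιr : V →L[ℝ] H := ι.restrictScalars ℝ with hιr
  set R := rieszAnti 𝕜 V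
  have hD : MemLp (fun t => R.symm (d t)) 2 (volume.restrict (Ioo 0 τ)) :=
    (R.symm : (V →L⋆[𝕜] 𝕜) →L[𝕜] V).comp_memLp' (Lp.memLp d)
  have wd : HasWeakDeriv τ (fun t => ιr.adjoint (ιr (v t))) (fun t => R.symm (d t)) := by
    refine (h.deriv.map ((toAntiDual ι).comp_memLp' (Lp.memLp u)) (Lp.memLp d)
      (R.symm : (V →L⋆[𝕜] 𝕜) →L[𝕜] V)).congr ?_ (ae_eq_refl _)
    filter_upwards [h.emb] with t ht
    rw [ht, ← rieszAnti_adjoint_restrictScalars hV hH]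
    exact R.symm_apply_apply _
  obtain ⟨w, wc, we, wn⟩ := exists_continuous_representative hτ (ι := ιr) hι (Lp.memLp v) hD wd
  have := hb.norm_le hτ hΦ wc (h.emb.trans we)
  have e : ∀ t, ⟪R.symm (d t), v t⟫_ℝ = RCLike.re (d t (v t)) := fun t => by
    rw [real_inner_comm, hV, ← rieszAnti_apply, R.apply_symm_apply]
  simp only [e] at wn
  linarith

theorem graphC_re_inner_nonneg (hV : ∀ x y : V, ⟪x, y⟫_ℝ = RCLike.re ⟪x, y⟫_𝕜)
    (hH : ∀ x y : H, ⟪x, y⟫_ℝ = RCLike.re ⟪x, y⟫_𝕜) (hτ : 0 < τ) {ι : V →L[𝕜] H}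
    (hι : Function.Injective ι) {Φ : H →L[𝕜] H} (hΦ : ‖Φ‖ ≤ 1)
    {a : ℝ → V →ₗ[𝕜] V →ₗ⋆[𝕜] 𝕜} (ha : IsForm τ a) (hc : IsCoercive τ a) {u f : L2 τ H}
    (h : (u, f) ∈ graphC τ ι a Φ) : 0 ≤ RCLike.re ⟪u, f⟫_𝕜 := by
  obtain ⟨⟨v, d, g, hmr, hg, hdg⟩, hb⟩ := h
  simp only at hmr hdg hb
  obtain ⟨M, -, hM⟩ := ha.bounded
  obtain ⟨α, hα, hco⟩ := hc
  -- In `IsFormImage` the null set depends on the test vector. Almost all values of `v` lie in the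
  -- closure of a countable set, so countably many test vectors suffice to insert `v t`.
  have hgv : ∀ᵐ t ∂(volume.restrict (Ioo 0 τ)), g t (v t) = a t (v t) (v t) := by
    obtain ⟨s, ⟨c, hcc, hsc⟩, hvs⟩ := (Lp.aestronglyMeasurable v).isSeparable_ae_range
    have hall : ∀ᵐ t ∂(volume.restrict (Ioo 0 τ)), ∀ x ∈ c, g t x = a t (v t) x :=
      (ae_ball_iff hcc).2 fun x _ => hg x
    filter_upwards [hall, hvs, ae_restrict_mem measurableSet_Ioo] with t h1 h2 h3
    have hcont : Continuous (a t (v t)) :=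
      AddMonoidHomClass.continuous_of_bound (a t (v t)) (M * ‖v t‖)
        (hM t (Ioo_subset_Icc_self h3) (v t))
    exact (isClosed_eq (g t).continuous hcont).closure_subset_iff.2 h1 (hsc h2)
  have i1 : Integrable (fun t => RCLike.re (d t (v t))) (volume.restrict (Ioo 0 τ)) := by
    refine ((Lp.memLp d).norm.integrable_mul (Lp.memLp v).norm).mono' ?_ ?_
    · have e : ∀ t, d t (v t) = ⟪v t, (rieszAnti 𝕜 V).symm (d t)⟫_𝕜 := fun t => by
        rw [← rieszAnti_apply, (rieszAnti 𝕜 V).apply_symm_apply]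
      simp only [e]
      exact RCLike.continuous_re.comp_aestronglyMeasurable ((Lp.aestronglyMeasurable v).inner
        ((rieszAnti 𝕜 V).symm.continuous.comp_aestronglyMeasurable (Lp.aestronglyMeasurable d)))
    · exact ae_of_all _ fun t => (RCLike.abs_re_le_norm _).trans ((d t).le_opNorm _)
  have key : RCLike.re ⟪u, f⟫_𝕜 = ∫ t in Ioo 0 τ, RCLike.re ⟪u t, f t⟫_𝕜 := by
    rw [L2.inner_def]
    exact (integral_re (L2.integrable_inner u f)).symm
  rw [key]
  refine (hmr.integral_nonneg hV hH hτ hι hΦ hb).trans ?_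
  refine integral_mono_ae i1 (L2.integrable_inner u f).re ?_
  filter_upwards [hmr.emb, hdg, hgv, ae_restrict_mem measurableSet_Ioo] with t h1 h2 h3 h4
  have : ⟪u t, f t⟫_𝕜 = d t (v t) + g t (v t) := by
    rw [h1, ← toAntiDual_apply, ← h2]; rfl
  simp only [this, h3, map_add]
  have := hco t (Ioo_subset_Icc_self h4) (v t)
  have : 0 ≤ α * ‖v t‖ ^ 2 := by positivity
  linarith

end Restrict
-- Existence and m-accretivity for `C` over `𝕜`
section RealPart

variable {𝕜 : Type*} [RCLike 𝕜]
  {V : Type*} [NormedAddCommGroup V] [InnerProductSpace 𝕜 V]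
  [InnerProductSpace ℝ V] [IsScalarTower ℝ 𝕜 V]

/-- The real part of a sesquilinear form, as a real bilinear form. -/
noncomputable def reForm (a : V →ₗ[𝕜] V →ₗ⋆[𝕜] 𝕜) : V →ₗ[ℝ] V →ₗ[ℝ] ℝ :=
  LinearMap.mk₂ ℝ (fun v w => RCLike.re (a v w)) (fun v v' w => by simp)
    (fun r v w => by
      rw [← algebraMap_smul 𝕜 r v, map_smul, LinearMap.smul_apply]
      exact RCLike.re_ofReal_mul _ _) (fun v w w' => by simp)
    (fun r v w => by
      rw [← algebraMap_smul 𝕜 r w, map_smulₛₗ, RCLike.algebraMap_eq_ofReal, RCLike.conj_ofReal]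
      exact RCLike.re_ofReal_mul _ _)

theorem reForm_apply (a : V →ₗ[𝕜] V →ₗ⋆[𝕜] 𝕜) (v w : V) : reForm a v w = RCLike.re (a v w) := rfl

theorem IsForm.exists_isRealForm {τ : ℝ} {a : ℝ → V →ₗ[𝕜] V →ₗ⋆[𝕜] 𝕜} (ha : IsForm τ a)
    (hc : IsCoercive τ a) : ∃ M α, IsRealForm τ M α fun t => reForm (a t) := by
  obtain ⟨M, hM0, hM⟩ := ha.bounded
  obtain ⟨α, hα, hco⟩ := hc
  exact ⟨M, α, fun v w => (RCLike.continuous_re.measurable.comp_aemeasurable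
      ((ha.measurable v w).mono_measure
        (Measure.restrict_mono Ioo_subset_Icc_self le_rfl))).aestronglyMeasurable, hM0,
    fun t ht v w => (RCLike.abs_re_le_norm _).trans (hM t (Ioo_subset_Icc_self ht) v w), hα,
    fun t ht v => hco t (Ioo_subset_Icc_self ht) v⟩

omit [InnerProductSpace ℝ V] [IsScalarTower ℝ 𝕜 V] in
theorem eq_of_re_eq {ψ χ : V →ₗ⋆[𝕜] 𝕜} {x : V} (h1 : RCLike.re (ψ x) = RCLike.re (χ x))
    (h2 : RCLike.re (ψ ((RCLike.I : 𝕜) • x)) = RCLike.re (χ ((RCLike.I : 𝕜) • x))) :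
    ψ x = χ x := by
  refine RCLike.ext h1 ?_
  simpa using h2

variable [CompleteSpace V]
  {H : Type*} [NormedAddCommGroup H] [InnerProductSpace 𝕜 H] [CompleteSpace H]
  [InnerProductSpace ℝ H] [IsScalarTower ℝ 𝕜 H]

/-- The real problem for `Re a` is solved first. The identity for `G` then holds for real parts
only, and testing with both `x` and `I • x` recovers it in `𝕜`. -/
theorem exists_mem_graphC (hV : ∀ x y : V, ⟪x, y⟫_ℝ = RCLike.re ⟪x, y⟫_𝕜)
    (hH : ∀ x y : H, ⟪x, y⟫_ℝ = RCLike.re ⟪x, y⟫_𝕜) {τ : ℝ} (hτ : 0 < τ) {ι : V →L[𝕜] H}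
    (hι : Function.Injective ι) (hd : DenseRange ι) {Φ : H →L[𝕜] H} (hΦ : ‖Φ‖ ≤ 1)
    {a : ℝ → V →ₗ[𝕜] V →ₗ⋆[𝕜] 𝕜} (ha : IsForm τ a) (hc : IsCoercive τ a) {l : ℝ} (hl : 0 < l)
    (f : L2 τ H) : ∃ u : L2 τ H, (u, f - (l : 𝕜) • u) ∈ graphC τ ι a Φ := by
  set ιr : V →L[ℝ] H := ι.restrictScalars ℝ with hιr
  set R := rieszAnti 𝕜 V with hR
  obtain ⟨M, α, hb⟩ := ha.exists_isRealForm hc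
  obtain ⟨v, G, w, hG, wd, wc, we, wb⟩ := exists_solution hτ (ι := ιr) hι hd
    (Φ := Φ.restrictScalars ℝ) (by simpa using hΦ) hb hl f
  set u : L2 τ H := ι.compLp v with hu
  set F : L2 τ H := f - (l : 𝕜) • u with hF
  set D : L2 τ V := ιr.adjoint.compLp F - G with hD
  have eu : u =ᵐ[volume.restrict (Ioo 0 τ)] fun t => ι (v t) := ι.coeFn_compLp v
  have eF : F =ᵐ[volume.restrict (Ioo 0 τ)] fun t => f t - l • ι (v t) := by
    filter_upwards [eu, Lp.coeFn_sub f ((l : 𝕜) • u), Lp.coeFn_smul (l : 𝕜) u] with t h1 h2 h3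
    rw [hF, h2, Pi.sub_apply, h3, Pi.smul_apply, h1, ← algebraMap_smul 𝕜 l (ι (v t))]
  have eD : D =ᵐ[volume.restrict (Ioo 0 τ)] fun t => ιr.adjoint (F t) - G t := by
    filter_upwards [Lp.coeFn_sub (ιr.adjoint.compLp F) G, ιr.adjoint.coeFn_compLp F] with t h1 h2
    rw [hD, h1, Pi.sub_apply, h2]
  have wd1 : HasWeakDeriv τ (fun t => ιr.adjoint (ιr (v t))) D := by
    refine wd.congr (ae_eq_refl _) ?_
    filter_upwards [eD, eF] with t h1 h2
    rw [h1, h2]; rfl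
  let R' : V →L[𝕜] (V →L⋆[𝕜] 𝕜) := R
  refine ⟨u, ⟨v, R'.compLp D, R'.compLp G, ⟨eu, ?_⟩, fun x => ?_, ?_⟩, w, wc, eu.trans we, wb⟩
  · refine (wd1.map ((ιr.adjoint.comp ιr).comp_memLp' (Lp.memLp v)) (Lp.memLp D) R').congr ?_
      (Filter.EventuallyEq.symm (R'.coeFn_compLp D))
    filter_upwards [eu] with t h1
    rw [h1, ← rieszAnti_adjoint_restrictScalars hV hH]; rfl
  · filter_upwards [R'.coeFn_compLp G, hG x, hG ((RCLike.I : 𝕜) • x)] with t h1 h2 h3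
    rw [h1]
    rw [real_inner_comm, hV, reForm_apply] at h2 h3
    exact eq_of_re_eq (ψ := (R' (G t) : V →ₗ⋆[𝕜] 𝕜)) h2 h3
  · filter_upwards [R'.coeFn_compLp D, R'.coeFn_compLp G, eD] with t h1 h2 h3
    rw [h1, h2, h3, ← map_add, sub_add_cancel]
    exact rieszAnti_adjoint_restrictScalars hV hH ι (F t)

theorem isMAccretive_opC {τ : ℝ} (hV : ∀ x y : V, ⟪x, y⟫_ℝ = RCLike.re ⟪x, y⟫_𝕜)
    (hH : ∀ x y : H, ⟪x, y⟫_ℝ = RCLike.re ⟪x, y⟫_𝕜) (hτ : 0 < τ) {ι : V →L[𝕜] H}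
    (hι : Function.Injective ι) (hd : DenseRange ι) {Φ : H →L[𝕜] H} (hΦ : ‖Φ‖ ≤ 1)
    {a : ℝ → V →ₗ[𝕜] V →ₗ⋆[𝕜] 𝕜} (ha : IsForm τ a) (hc : IsCoercive τ a) :
    IsMAccretive (opC τ ι a Φ) := by
  refine isMAccretive_of_graph _ ?_ ?_ <;> rw [graph_opC hι hd]
  · exact fun u f h => graphC_re_inner_nonneg hV hH hτ hι hΦ ha hc h
  · exact fun l hl f => exists_mem_graphC hV hH hτ hι hd hΦ ha hc hl f

end RealPart

/-! ### The operator `d/dt` -/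

section OperatorB

variable {𝕜 : Type*} [RCLike 𝕜] {H : Type*} [NormedAddCommGroup H] [InnerProductSpace 𝕜 H]
  [CompleteSpace H] [InnerProductSpace ℝ H] [IsScalarTower ℝ 𝕜 H] {τ : ℝ}

theorem adjoint_id_apply {E : Type*} [NormedAddCommGroup E] [InnerProductSpace ℝ E]
    [CompleteSpace E] (x : E) : (ContinuousLinearMap.id ℝ E).adjoint x = x :=
  ext_inner_left ℝ fun w => by rw [ContinuousLinearMap.adjoint_inner_right]; rfl

omit [IsScalarTower ℝ 𝕜 H] in
theorem re_inner_nonneg_of_hasWeakDeriv (hH : ∀ x y : H, ⟪x, y⟫_ℝ = RCLike.re ⟪x, y⟫_𝕜)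
    (hτ : 0 < τ) {Φ : H →L[𝕜] H} (hΦ : ‖Φ‖ ≤ 1) {u f : L2 τ H} (h : HasWeakDeriv τ u f)
    (hb : TimeBoundary τ Φ u) : 0 ≤ RCLike.re ⟪u, f⟫_𝕜 := by
  have wd : HasWeakDeriv τ (fun t => (ContinuousLinearMap.id ℝ H).adjoint
      (ContinuousLinearMap.id ℝ H (u t))) f := by
    simp only [adjoint_id_apply]; exact h
  obtain ⟨w, wc, we, wn⟩ := exists_continuous_representative hτ (ι := ContinuousLinearMap.id ℝ H)
    Function.injective_id (Lp.memLp u) (Lp.memLp f) wd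
  have hn := hb.norm_le hτ hΦ wc we
  have key : RCLike.re ⟪u, f⟫_𝕜 = ∫ t in Ioo 0 τ, RCLike.re ⟪u t, f t⟫_𝕜 := by
    rw [L2.inner_def]
    exact (integral_re (L2.integrable_inner u f)).symm
  have hc : ∀ x y : H, ⟪x, y⟫_ℝ = RCLike.re ⟪y, x⟫_𝕜 := fun x y => by rw [real_inner_comm, hH]
  simp only [hc] at wn
  rw [key]
  linarith

theorem exists_hasWeakDeriv (hτ : 0 < τ) {Φ : H →L[𝕜] H} (hΦ : ‖Φ‖ ≤ 1) {l : ℝ} (hl : 0 < l)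
    (f : L2 τ H) : ∃ u : L2 τ H, HasWeakDeriv τ u (f - (l : 𝕜) • u : L2 τ H) ∧
      TimeBoundary τ Φ u := by
  -- The existence theorem needs a coercive form and a positive shift. Both come from `l = l/2 +
  -- l/2`.
  have hl2 : 0 < l / 2 := by positivity
  have hb : IsRealForm τ (l / 2) (l / 2) fun _ => (l / 2) • innerₗ H := by
    refine ⟨fun v w => aestronglyMeasurable_const, hl2.le, fun t _ v w => ?_, hl2, fun t _ v => ?_⟩
    · change |l / 2 * ⟪v, w⟫_ℝ| ≤ _
      rw [abs_mul, abs_of_pos hl2, mul_assoc]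
      exact mul_le_mul_of_nonneg_left (abs_real_inner_le_norm v w) hl2.le
    · change _ ≤ l / 2 * ⟪v, v⟫_ℝ
      rw [real_inner_self_eq_norm_sq]
  obtain ⟨u, G, w, hG, wd, wc, we, wb⟩ := exists_solution hτ (ι := ContinuousLinearMap.id ℝ H)
    Function.injective_id denseRange_id (Φ := Φ.restrictScalars ℝ) (by simpa using hΦ) hb hl2 f
  refine ⟨u, ?_, w, wc, we, wb⟩
  -- `G` is known only tested against each fixed vector, with a null set depending on it.
  -- Separability of the essential range turns this into equality almost everywhere.
  have eG : ∀ᵐ t ∂(volume.restrict (Ioo 0 τ)), G t = (l / 2) • u t := by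
    set E : L2 τ H := G - (l / 2) • u with hE
    have eE : E =ᵐ[volume.restrict (Ioo 0 τ)] fun t => G t - (l / 2) • u t := by
      filter_upwards [Lp.coeFn_sub G ((l / 2) • u), Lp.coeFn_smul (l / 2) u] with t h1 h2
      rw [hE, h1, Pi.sub_apply, h2, Pi.smul_apply]
    obtain ⟨s, hs, hsE⟩ := (Lp.aestronglyMeasurable E).isSeparable_ae_range
    have h0 : E =ᵐ[volume.restrict (Ioo 0 τ)] 0 := by
      refine ae_eq_zero_of_forall_dual_of_isSeparable ℝ hs (fun c => ?_) hsE
      obtain ⟨y, rfl⟩ := (InnerProductSpace.toDual ℝ H).surjective c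
      filter_upwards [eE, hG y] with t h1 h2
      rw [InnerProductSpace.toDual_apply_apply, h1, inner_sub_right, real_inner_comm, h2,
        real_inner_smul_right, real_inner_comm]
      exact sub_self _
    filter_upwards [eE, h0] with t h1 h2
    rw [h1] at h2
    exact sub_eq_zero.1 h2
  refine wd.congr (ae_of_all _ fun t => adjoint_id_apply _) ?_
  filter_upwards [eG, Lp.coeFn_sub f ((l : 𝕜) • u), Lp.coeFn_smul (l : 𝕜) u] with t h1 h2 h3
  have hs : ((l : 𝕜) • u : L2 τ H) t = l • u t := by
    rw [h3, Pi.smul_apply, ← algebraMap_smul 𝕜 l (u t)]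
  rw [h2, Pi.sub_apply, hs, h1]
  rw [adjoint_id_apply]
  change f t - (l / 2) • u t - (l / 2) • u t = _
  rw [sub_sub, ← add_smul, add_halves]

end OperatorB

theorem isMAccretive_opB {𝕜 : Type*} [RCLike 𝕜] {H : Type*} [NormedAddCommGroup H]
    [InnerProductSpace 𝕜 H] [CompleteSpace H] {τ : ℝ} (hτ : 0 < τ) {Φ : H →L[𝕜] H}
    (hΦ : ‖Φ‖ ≤ 1) : IsMAccretive (opB τ Φ) := by
  let _ : InnerProductSpace ℝ H := InnerProductSpace.rclikeToReal 𝕜 H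
  have : IsScalarTower ℝ 𝕜 H := RestrictScalars.isScalarTower ℝ 𝕜 H
  refine isMAccretive_of_graph _ ?_ ?_ <;> rw [graph_opB]
  · exact fun u f h => re_inner_nonneg_of_hasWeakDeriv (fun _ _ => rfl) hτ hΦ h.1 h.2
  · intro l hl f
    exact exists_hasWeakDeriv hτ hΦ hl f

end TimeBVP

theorem theorem5p8 {𝕜 : Type*} [RCLike 𝕜]
    {H : Type*} [NormedAddCommGroup H] [InnerProductSpace 𝕜 H] [CompleteSpace H]
    (τ : ℝ) (hτ : 0 < τ) (Φ : H →L[𝕜] H) (hΦ : ‖Φ‖ ≤ 1) :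
    (∀ (V : Type*) [NormedAddCommGroup V] [InnerProductSpace 𝕜 V] [CompleteSpace V]
      (ι : V →L[𝕜] H), Function.Injective ι → DenseRange ι →
      ∀ a : ℝ → V →ₗ[𝕜] V →ₗ⋆[𝕜] 𝕜, TimeBVP.IsForm τ a → TimeBVP.IsCoercive τ a →
        TimeBVP.IsMAccretive (TimeBVP.opC τ ι a Φ)) ∧
    TimeBVP.IsMAccretive (TimeBVP.opB τ Φ) := by
  refine ⟨fun V _ _ _ ι hι hd a ha hc => ?_, TimeBVP.isMAccretive_opB hτ hΦ⟩
  -- With the real structures defined by restriction, the real inner product is the real part of the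
  -- given one by definition.
  let _ : InnerProductSpace ℝ H := InnerProductSpace.rclikeToReal 𝕜 H
  have : IsScalarTower ℝ 𝕜 H := RestrictScalars.isScalarTower ℝ 𝕜 H
  let _ : InnerProductSpace ℝ V := InnerProductSpace.rclikeToReal 𝕜 V
  have : IsScalarTower ℝ 𝕜 V := RestrictScalars.isScalarTower ℝ 𝕜 V
  exact TimeBVP.isMAccretive_opC (fun _ _ => rfl) (fun _ _ => rfl) hτ hι hd hΦ ha hc
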